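/- Conventions. A lattice is a finitely generated $\mathbb Z$-submodule $L$ spanning a positive definite quadratic space $(V,B)$ over $\mathbb Q$, with $Q(x)=B(x,x)$; its rank is $\dim V$, and it is integral if $B(L,L)\subseteq\mathbb Z$. For a prime $q$, $L_q=\mathbb Z_qL\subseteq\mathbb Q_q\otimes V$. An integral lattice $L$ is normalized if the ideal $\mathfrak n(L)$ generated by all $Q(x)$, $x\in L$, is $2\mathbb Z$. A lattice $N$ is primitively represented by $L$ if some isometry maps $N$ onto a direct summand of $L$; it is primitively represented by the genus of $L$ if it is primitively represented by some lattice $K$ with $K_q\cong L_q$ for all primes $q$. $L$ is strictly $n$-regular if it primitively represents all integral lattices of rank $n$ that are primitively represented by its genus. For a positive integer $m$ put $$\Lambda_m(L)=\{x\in L : Q(x+z)\equiv Q(z) \bmod m \text{ for all } z\in L\},$$ and for a positive rational number $r$ let $\Lambda_m^{(r)}(L)$ be $\Lambda_m(L)$ with its quadratic map scaled by $r$. For a finite (possibly empty) sequence $\mathbf r=(r_1,\dots,r_k)$ of positive rational numbers put $\Lambda_m^{(\mathbf r)}=\Lambda_m^{(r_k)}\circ\cdots\circ\Lambda_m^{(r_1)}$.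 For a prime $p$, $\mathbf r$ is admissible to $L$ and $p$ if $\Lambda_{2p}^{(r_i)}\circ\cdots\circ\Lambda_{2p}^{(r_1)}(L)$ is normalized for every $1\le i\le k$. Corollary 3.5. Let $n\ge 0$ and let $L$ be a normalized strictly $n$-regular lattice of rank at least $4$. For every prime $p$ there exists a sequence $\mathbf r$ admissible to $L$ and $p$ such that, with $L'=\Lambda_{2p}^{(\mathbf r)}(L)$, 1. $L'$ is normalized and strictly $n$-regular; 2. $\{Q(x) : x\in L'_p\}=2\mathbb Z_p$; 3. for every prime $q\neq p$, $L'_q$ is isometric to the lattice obtained from $L_q$ by scaling its quadratic map by some positive rational number; 4. if $L_p$ is isotropic, then $L'_p$ is split by the hyperbolic plane $\mathbb H=\left(\begin{smallmatrix}0&1\\1&0\end{smallmatrix}\right)$, that is, $L'_p\cong\mathbb H\perp M$ for some $\mathbb Z_p$-lattice $M$. -/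

import Mathlib

open scoped TensorProduct

universe u

/-- A positive definite `ℤ`-lattice on the quadratic space `(V, form)` over `ℚ`: a finitely
generated `ℤ`-submodule of `V` that spans `V`.  The quadratic map is `Q x = form x x`.
Integrality is the separate predicate `QLattice.IsIntegral`. -/
structure QLattice (V : Type u) [AddCommGroup V] [Module ℚ V] where
  form : LinearMap.BilinForm ℚ V
  symm : ∀ x y, form x y = form y x
  pos : ∀ x, x ≠ 0 → 0 < form x x
  lat : Submodule ℤ V
  fg : lat.FG
  full : Submodule.span ℚ (lat : Set V) = ⊤

namespace QLattice

variable {V : Type u} [AddCommGroup V] [Module ℚ V]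
variable {W : Type u} [AddCommGroup W] [Module ℚ W]

/-- The quadratic map `Q x = B(x, x)`. -/
def Q (L : QLattice V) (x : V) : ℚ := L.form x x

/-- The rank of a lattice, the dimension of the space it spans. -/
noncomputable def rank (_L : QLattice V) : ℕ := Module.finrank ℚ V

/-- The scale `s(L)`, generated by all `B(x, y)` with `x, y ∈ L`. -/
def scaleIdeal (L : QLattice V) : Submodule ℤ ℚ :=
  Submodule.span ℤ {a | ∃ x ∈ L.lat, ∃ y ∈ L.lat, a = L.form x y}

/-- The norm `n(L)`, generated by all `Q x` with `x ∈ L`. -/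
def normIdeal (L : QLattice V) : Submodule ℤ ℚ :=
  Submodule.span ℤ {a | ∃ x ∈ L.lat, a = L.Q x}

/-- `s(L) ⊆ ℤ`. -/
def IsIntegral (L : QLattice V) : Prop :=
  L.scaleIdeal ≤ Submodule.span ℤ {(1 : ℚ)}

/-- An integral lattice with `n(L) = 2ℤ`. -/
def IsNormalized (L : QLattice V) : Prop :=
  L.IsIntegral ∧ L.normIdeal = Submodule.span ℤ {(2 : ℚ)}

/-! ### Primitive representations -/

/-- `M` is primitively represented by `L`: an isometry `σ` of the space of `M` into the space of
`L` maps `M` onto a direct summand of `L`. -/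
def PrimitivelyRepresentedBy (M : QLattice W) (L : QLattice V) : Prop :=
  ∃ σ : W →ₗ[ℚ] V, (∀ x y, L.form (σ x) (σ y) = M.form x y) ∧
    ∃ C : Submodule ℤ V, Disjoint (M.lat.map (σ.restrictScalars ℤ)) C ∧
      M.lat.map (σ.restrictScalars ℤ) ⊔ C = L.lat

/-! ### Localizations -/

section LocalLattice

variable (p : ℕ) [Fact p.Prime]

/-- The bilinear form on `V_p = ℚ_p ⊗ V`. -/
noncomputable def localForm (L : QLattice V) : LinearMap.BilinForm ℚ_[p] (ℚ_[p] ⊗[ℚ] V) :=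
  L.form.baseChange ℚ_[p]

/-- The localization `L_p`, the `ℤ_p`-submodule of `V_p` generated by `L`. -/
noncomputable def localLat (L : QLattice V) : Submodule ℤ_[p] (ℚ_[p] ⊗[ℚ] V) :=
  Submodule.span ℤ_[p] ((fun v : V => (1 : ℚ_[p]) ⊗ₜ[ℚ] v) '' (L.lat : Set V))

/-- `M_p` is isometric to the `ℤ_p`-lattice obtained from `L_p` by scaling its bilinear form
(equivalently, its quadratic map) by `c`. -/
def LocallyIsometricScaled (c : ℚ_[p]) (L : QLattice V) (M : QLattice W) : Prop :=
  ∃ σ : (ℚ_[p] ⊗[ℚ] V) ≃ₗ[ℚ_[p]] (ℚ_[p] ⊗[ℚ] W),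
    (∀ x y, M.localForm p (σ x) (σ y) = c * L.localForm p x y) ∧
      σ '' (L.localLat p : Set (ℚ_[p] ⊗[ℚ] V)) = (M.localLat p : Set (ℚ_[p] ⊗[ℚ] W))

/-- `L_p ≅ M_p`. -/
def LocallyIsometric (L : QLattice V) (M : QLattice W) : Prop :=
  L.LocallyIsometricScaled p 1 M

/-- The set `Q(L_p)` of values of the quadratic map on `L_p`. -/
def localValues (L : QLattice V) : Set ℚ_[p] :=
  {a | ∃ x ∈ L.localLat p, a = L.localForm p x x}

/-- `L_p` is isotropic. -/
def IsIsotropicAt (L : QLattice V) : Prop :=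
  ∃ x ∈ L.localLat p, x ≠ 0 ∧ L.localForm p x x = 0

/-- `L_p` is split by the hyperbolic plane: `L_p = ℤ_p[e, f] ⊥ M`, where the Gram matrix of
`e, f` has the rows `(0, 1)` and `(1, 0)`. -/
def IsSplitByHyperbolicAt (L : QLattice V) : Prop :=
  ∃ (e f : ℚ_[p] ⊗[ℚ] V) (M : Submodule ℤ_[p] (ℚ_[p] ⊗[ℚ] V)),
    L.localForm p e e = 0 ∧ L.localForm p f f = 0 ∧ L.localForm p e f = 1 ∧
      (∀ x ∈ M, L.localForm p e x = 0 ∧ L.localForm p f x = 0) ∧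
      Disjoint (Submodule.span ℤ_[p] {e, f}) M ∧
      Submodule.span ℤ_[p] {e, f} ⊔ M = L.localLat p

end LocalLattice

/-- `K` lies in the genus of `L`: `K_p ≅ L_p` for all primes `p`.  The condition at the real
place holds as well, since both lattices are positive definite, of the same rank. -/
def InGenus (K : QLattice W) (L : QLattice V) : Prop :=
  ∀ (p : ℕ) [Fact p.Prime], L.LocallyIsometric p K

/-- `L` is strictly `n`-regular: it primitively represents every (integral) lattice `N` of rank
`n` that is primitively represented by some lattice in the genus of `L`. -/
def IsStrictlyRegular (n : ℕ) (L : QLattice V) : Prop :=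
  ∀ (W : Type u) [AddCommGroup W] [Module ℚ W] (N : QLattice W),
    N.IsIntegral → N.rank = n →
    (∃ (U : Type u) (_ : AddCommGroup U) (_ : Module ℚ U) (K : QLattice U),
      K.InGenus L ∧ N.PrimitivelyRepresentedBy K) →
    N.PrimitivelyRepresentedBy L

/-! ### Watson transformations -/

/-- `Λ_m(L) = {x ∈ L : Q (x + z) ≡ Q z mod m for all z ∈ L}`. -/
def watsonLat (m : ℕ) (L : QLattice V) : Submodule ℤ V :=
  AddSubgroup.toIntSubmodule
    { carrier := {x | x ∈ L.lat ∧ ∀ z ∈ L.lat, ∃ k : ℤ, L.Q (x + z) - L.Q z = m * k}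
      zero_mem' := ⟨L.lat.zero_mem, fun z _ => ⟨0, by simp⟩⟩
      add_mem' := by
        rintro x y ⟨hx, hx'⟩ ⟨hy, hy'⟩
        refine ⟨L.lat.add_mem hx hy, fun z hz => ?_⟩
        obtain ⟨k, hk⟩ := hx' (y + z) (L.lat.add_mem hy hz)
        obtain ⟨l, hl⟩ := hy' z hz
        refine ⟨k + l, ?_⟩
        rw [add_assoc]
        push_cast
        linear_combination hk + hl
      neg_mem' := by
        rintro x ⟨hx, hx'⟩
        refine ⟨L.lat.neg_mem hx, fun z hz => ?_⟩
        obtain ⟨k, hk⟩ := hx' (-x + z) (L.lat.add_mem (L.lat.neg_mem hx) hz)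
        refine ⟨-k, ?_⟩
        rw [add_neg_cancel_left] at hk
        push_cast
        linear_combination -hk }

theorem mem_watsonLat (m : ℕ) (L : QLattice V) (x : V) :
    x ∈ L.watsonLat m ↔
      x ∈ L.lat ∧ ∀ z ∈ L.lat, ∃ k : ℤ, L.Q (x + z) - L.Q z = m * k :=
  Iff.rfl

theorem watsonLat_le (m : ℕ) (L : QLattice V) : L.watsonLat m ≤ L.lat :=
  fun _ hx => hx.1

theorem fg_watsonLat (m : ℕ) (L : QLattice V) : (L.watsonLat m).FG := by
  have : IsNoetherian ℤ L.lat := isNoetherian_of_fg_of_noetherian L.lat L.fg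
  have h : ((L.watsonLat m).comap L.lat.subtype).FG := IsNoetherian.noetherian _
  have h2 := h.map L.lat.subtype
  rwa [Submodule.map_comap_subtype, inf_eq_right.mpr (L.watsonLat_le m)] at h2

/-- The values `B(x, z)`, `z ∈ L`, have a common denominator. -/
theorem exists_denominator (L : QLattice V) (x : V) :
    ∃ d : ℤ, d ≠ 0 ∧ ∀ z ∈ L.lat, ∃ k : ℤ, d * L.form x z = k := by
  obtain ⟨s, hs⟩ := L.fg
  refine ⟨∏ y ∈ s, ((L.form x y).den : ℤ), ?_, ?_⟩
  · exact Finset.prod_ne_zero_iff.mpr fun y _ => by exact_mod_cast (L.form x y).den_nz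
  · intro z hz
    rw [← hs] at hz
    induction hz using Submodule.span_induction with
    | mem y hy =>
      obtain ⟨c, hc⟩ := Finset.dvd_prod_of_mem (fun y => ((L.form x y).den : ℤ)) hy
      refine ⟨c * (L.form x y).num, ?_⟩
      rw [hc]
      push_cast
      linear_combination (c : ℚ) * (Rat.den_mul_eq_num (L.form x y))
    | zero => exact ⟨0, by simp⟩
    | add y z _ _ hy hz =>
      obtain ⟨k, hk⟩ := hy
      obtain ⟨l, hl⟩ := hz
      exact ⟨k + l, by rw [map_add, Int.cast_add]; linear_combination hk + hl⟩
    | smul a y _ hy =>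
      obtain ⟨k, hk⟩ := hy
      refine ⟨a * k, ?_⟩
      rw [map_zsmul, zsmul_eq_mul, Int.cast_mul]
      linear_combination (a : ℚ) * hk

theorem full_watsonLat {m : ℕ} (hm : 0 < m) (L : QLattice V) :
    Submodule.span ℚ (L.watsonLat m : Set V) = ⊤ := by
  rw [eq_top_iff, ← L.full, Submodule.span_le]
  intro x hx
  obtain ⟨d, hd, h⟩ := L.exists_denominator x
  have hmem : (m * d : ℤ) • x ∈ L.watsonLat m := by
    refine ⟨L.lat.smul_mem _ hx, fun z hz => ?_⟩
    obtain ⟨k, hk⟩ := h x hx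
    obtain ⟨l, hl⟩ := h z hz
    refine ⟨m * d * k + 2 * l, ?_⟩
    simp only [Q, map_add, map_zsmul, LinearMap.add_apply, LinearMap.smul_apply, zsmul_eq_mul,
      L.symm z x]
    push_cast
    linear_combination (m : ℚ) * m * d * hk + 2 * (m : ℚ) * hl
  have hne : ((m * d : ℤ) : ℚ) ≠ 0 := by
    have : (m : ℤ) ≠ 0 := by exact_mod_cast hm.ne'
    exact_mod_cast mul_ne_zero this hd
  have h2 := Submodule.smul_mem (Submodule.span ℚ (L.watsonLat m : Set V))
    (((m * d : ℤ) : ℚ)⁻¹) (Submodule.subset_span hmem)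
  rwa [← Int.cast_smul_eq_zsmul ℚ, smul_smul, inv_mul_cancel₀ hne, one_smul] at h2

/-- `Λ_m^{(r)}(L)`: the lattice `Λ_m(L)`, its quadratic map scaled by the positive rational
number `r`. -/
def watson (m : ℕ) (hm : 0 < m) (r : {r : ℚ // 0 < r}) (L : QLattice V) : QLattice V where
  form := r.1 • L.form
  symm x y := by simp [L.symm x y]
  pos x hx := by simpa using mul_pos r.2 (L.pos x hx)
  lat := L.watsonLat m
  fg := L.fg_watsonLat m
  full := L.full_watsonLat hm

/-- `Λ_m^{(r₁, …, r_k)}(L) = Λ_m^{(r_k)} (⋯ (Λ_m^{(r₁)} L))`. -/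
def watsonSeq (m : ℕ) (hm : 0 < m) : List {r : ℚ // 0 < r} → QLattice V → QLattice V
  | [], L => L
  | r :: rs, L => watsonSeq m hm rs (L.watson m hm r)

/-- The sequence `r₁, …, r_k` is admissible: `Λ_m^{(r₁, …, r_i)}(L)` is normalized for every
`1 ≤ i ≤ k`. -/
def Admissible (m : ℕ) (hm : 0 < m) (r : List {r : ℚ // 0 < r}) (L : QLattice V) : Prop :=
  ∀ i < r.length, (L.watsonSeq m hm (r.take (i + 1))).IsNormalized

end QLattice

namespace QLattice

variable {V : Type u} [AddCommGroup V] [Module ℚ V]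
variable {W : Type u} [AddCommGroup W] [Module ℚ W]

/-! ### Bases and coordinates -/

/-! Call a normalized lattice anisotropic at `p` if every `x` with `Q x ∈ 2pℤ` pairs it into `pℤ`
(`IsWatsonAnisotropic`). If this fails, some `x` with `Q x ∈ 2pℤ` pairs to a `p`-adic unit with some
`y`; Hensel's lemma deforms `x` to an isotropic vector, and a hyperbolic plane splits off at `p`.
That plane already takes all values in `2ℤ_p`.

If it holds, `Λ_{2p}(L)` is cut out of `L` by the values of `Q` alone. Such a condition is respected
by every isometry, so lattices in the genus of `Λ_{2p}(L)` lift to lattices in the genus of `L`, and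
primitive representations, viewed as pullbacks, go up and come down again. Hence strict regularity
is inherited (`IsStrictlyRegular.sublattice`). After several such steps the lattice is `{x ∈ L : Q x
∈ 2p^m ℤ}` with form divided by `p^m` (`IsWatsonChain`).

Iterate. Either some stage is not anisotropic, and its hyperbolic plane finishes the proof, or `m`
becomes arbitrarily large. Then for large `m` the sets above, being groups, lie in `pL`
(`exists_bound_dvd`); descent shows that `L_p` is anisotropic, so the last claim is vacuous. At such
a stage `L'` the residue forms on `L'/Λ` and `Λ/pL'`, with `Λ = Λ_{2p}(L')`, are anisotropic over
`𝔽_p`. By Chevalley–Warning each has dimension at most 2, and rank at least 4 forces both to be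
binary. They represent all units and all `p` times units (up to the factor 2), and scaling by powers
of `p` gives all of `2ℤ_p`. -/

theorem exists_basis (L : QLattice V) :
    ∃ b : Module.Basis (Fin (Module.finrank ℚ V)) ℚ V,
      L.lat = Submodule.span ℤ (Set.range b) := by
  have : Module.Finite ℤ L.lat := Module.Finite.iff_fg.mpr L.fg
  have : IsAddTorsionFree V := IsAddTorsionFree.of_module_rat V
  have : Module.Free ℤ L.lat := Module.free_of_finite_type_torsion_free'
  let b₀ := Module.Free.chooseBasis ℤ L.lat
  have hli : LinearIndependent ℤ (fun i => (b₀ i : V)) :=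
    b₀.linearIndependent.map' L.lat.subtype (Submodule.ker_subtype _)
  rw [LinearIndependent.iff_fractionRing (R := ℤ) (K := ℚ)] at hli
  have hrange : Submodule.span ℤ (Set.range fun i => (b₀ i : V)) = L.lat := by
    have h := congrArg (Submodule.map L.lat.subtype) b₀.span_eq
    rw [Submodule.map_span, ← Set.range_comp, Submodule.map_subtype_top] at h
    exact h
  have hspan : ⊤ ≤ Submodule.span ℚ (Set.range fun i => (b₀ i : V)) := by
    rw [← L.full, Submodule.span_le]
    intro x hx
    exact Submodule.span_subset_span ℤ ℚ _ (hrange.ge hx)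
  let b := Module.Basis.mk hli hspan
  have hcard : Fintype.card (Module.Free.ChooseBasisIndex ℤ L.lat) = Module.finrank ℚ V :=
    (Module.finrank_eq_card_basis b).symm
  refine ⟨b.reindex (Fintype.equivFinOfCardEq hcard), ?_⟩
  rw [Module.Basis.range_reindex, Module.Basis.coe_mk, hrange]

section Basis

variable {ι : Type*} {L : QLattice V} {b : Module.Basis ι ℚ V}

theorem mem_lat_iff (hb : L.lat = Submodule.span ℤ (Set.range b)) (x : V) :
    x ∈ L.lat ↔ ∀ i, ∃ k : ℤ, b.repr x i = k := by
  rw [hb, Module.Basis.mem_span_iff_repr_mem ℤ b]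
  simp only [Set.mem_range, eq_comm, algebraMap_int_eq, Int.coe_castRingHom]

variable (p : ℕ) [Fact p.Prime]

theorem mem_localLat_iff (hb : L.lat = Submodule.span ℤ (Set.range b)) (x : ℚ_[p] ⊗[ℚ] V) :
    x ∈ L.localLat p ↔
      ∀ i, ∃ z : ℤ_[p], (Algebra.TensorProduct.basis ℚ_[p] b).repr x i = z := by
  have h : L.localLat p =
      Submodule.span ℤ_[p] (Set.range (Algebra.TensorProduct.basis ℚ_[p] b)) := by
    apply le_antisymm
    · refine Submodule.span_le.mpr ?_
      rintro _ ⟨v, hv, rfl⟩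
      rw [SetLike.mem_coe, hb] at hv
      induction hv using Submodule.span_induction with
      | mem y hy =>
        obtain ⟨i, rfl⟩ := hy
        exact Submodule.subset_span ⟨i, by simp⟩
      | zero => simp
      | add y z _ _ hy hz =>
        simp only [TensorProduct.tmul_add]
        exact Submodule.add_mem _ hy hz
      | smul a y _ hy =>
        have := Submodule.smul_of_tower_mem (Submodule.span ℤ_[p]
          (Set.range (Algebra.TensorProduct.basis ℚ_[p] b))) a hy
        simpa [TensorProduct.tmul_smul] using this
    · refine Submodule.span_le.mpr ?_
      rintro _ ⟨i, rfl⟩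
      refine Submodule.subset_span ⟨b i, ?_, by simp⟩
      rw [hb]
      exact Submodule.subset_span ⟨i, rfl⟩
  rw [h, Module.Basis.mem_span_iff_repr_mem ℤ_[p]]
  simp only [Set.mem_range, eq_comm, PadicInt.algebraMap_apply]

end Basis

/-! ### Localizations -/

section Local

variable (p : ℕ) [Fact p.Prime]

theorem intCast_eq_mul_of_padic {k : ℤ} {m : ℕ} {z : ℤ_[p]}
    (h : (k : ℚ_[p]) = (p : ℚ_[p]) ^ m * z) : ∃ l : ℤ, k = p ^ m * l := by
  have h2 : (k : ℤ_[p]) = (p : ℤ_[p]) ^ m * z := by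
    apply PadicInt.ext
    push_cast
    exact h
  have : ‖(k : ℤ_[p])‖ ≤ (p : ℝ) ^ (-m : ℤ) := by
    rw [h2, norm_mul, PadicInt.norm_p_pow]
    exact mul_le_of_le_one_right (by positivity) z.norm_le_one
  rw [PadicInt.norm_int_le_pow_iff_dvd] at this
  exact_mod_cast this

theorem tmul_mem_localLat {L : QLattice V} {x : V} (hx : x ∈ L.lat) :
    (1 : ℚ_[p]) ⊗ₜ[ℚ] x ∈ L.localLat p :=
  Submodule.subset_span ⟨x, hx, rfl⟩

theorem localLat_mono {L M : QLattice V} (h : L.lat ≤ M.lat) : L.localLat p ≤ M.localLat p :=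
  Submodule.span_mono (Set.image_mono h)

/-- An element of `V` lies in `L` as soon as it does so locally at `p` and up to a power of
`p`. -/
theorem mem_lat_of_local {L : QLattice V} {x : V} {m : ℕ} (hx : (p ^ m : ℤ) • x ∈ L.lat)
    (hxp : (1 : ℚ_[p]) ⊗ₜ[ℚ] x ∈ L.localLat p) : x ∈ L.lat := by
  obtain ⟨b, hb⟩ := L.exists_basis
  rw [mem_lat_iff hb] at hx ⊢
  rw [mem_localLat_iff p hb] at hxp
  intro i
  obtain ⟨k, hk⟩ := hx i
  obtain ⟨z, hz⟩ := hxp i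
  rw [Algebra.TensorProduct.basis_repr_tmul] at hz
  have hp : (p : ℚ) ^ m ≠ 0 := pow_ne_zero _ (by exact_mod_cast (Fact.out : p.Prime).ne_zero)
  have hk' : (p : ℚ) ^ m * b.repr x i = k := by
    rw [← hk, map_zsmul, Finsupp.smul_apply, zsmul_eq_mul]
    push_cast
    rfl
  have hz' : ((b.repr x i : ℚ) : ℚ_[p]) = z := by
    rw [← hz]
    simp
  obtain ⟨l, hl⟩ := intCast_eq_mul_of_padic p (k := k) (m := m) (z := z) (by
    rw [← hz']
    exact_mod_cast congrArg (fun t : ℚ => (t : ℚ_[p])) hk'.symm)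
  refine ⟨l, mul_left_cancel₀ hp ?_⟩
  rw [hk', hl]
  push_cast
  rfl

theorem exists_int_add_mul (a : ℤ_[p]) (m : ℕ) : ∃ (k : ℤ) (c : ℤ_[p]), a = k + p ^ m * c := by
  obtain ⟨c, hc⟩ := Ideal.mem_span_singleton.mp (PadicInt.appr_spec m a)
  refine ⟨a.appr m, c, ?_⟩
  push_cast
  linear_combination hc

/-- `L` is dense in `L_p`. -/
theorem exists_approx {L : QLattice V} {x : ℚ_[p] ⊗[ℚ] V} (hx : x ∈ L.localLat p) (m : ℕ) :
    ∃ z ∈ L.lat, ∃ w ∈ L.localLat p, x = (1 : ℚ_[p]) ⊗ₜ[ℚ] z + (p ^ m : ℤ_[p]) • w := by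
  induction hx using Submodule.span_induction with
  | mem y hy =>
    obtain ⟨v, hv, rfl⟩ := hy
    exact ⟨v, hv, 0, Submodule.zero_mem _, by simp⟩
  | zero => exact ⟨0, L.lat.zero_mem, 0, Submodule.zero_mem _, by simp⟩
  | add y z _ _ hy hz =>
    obtain ⟨v, hv, w, hw, rfl⟩ := hy
    obtain ⟨v', hv', w', hw', rfl⟩ := hz
    refine ⟨v + v', L.lat.add_mem hv hv', w + w', Submodule.add_mem _ hw hw', ?_⟩
    rw [TensorProduct.tmul_add, smul_add]
    abel
  | smul a y _ hy =>
    obtain ⟨v, hv, w, hw, rfl⟩ := hy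
    obtain ⟨k, c, hc⟩ := exists_int_add_mul p a m
    refine ⟨k • v, L.lat.smul_mem _ hv, c • (1 : ℚ_[p]) ⊗ₜ[ℚ] v + a • w,
      Submodule.add_mem _ (Submodule.smul_mem _ _ (tmul_mem_localLat p hv))
        (Submodule.smul_mem _ _ hw), ?_⟩
    have : (1 : ℚ_[p]) ⊗ₜ[ℚ] (k • v) = (k : ℤ_[p]) • (1 : ℚ_[p]) ⊗ₜ[ℚ] v := by
      rw [TensorProduct.tmul_smul, Int.cast_smul_eq_zsmul]
    have h2 : a • (1 : ℚ_[p]) ⊗ₜ[ℚ] v = (k : ℤ_[p]) • (1 : ℚ_[p]) ⊗ₜ[ℚ] v +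
        (p ^ m : ℤ_[p]) • c • (1 : ℚ_[p]) ⊗ₜ[ℚ] v := by
      rw [smul_smul, ← add_smul, ← hc]
    rw [this, smul_add, smul_add, h2, smul_comm a]
    abel

theorem localForm_tmul (L : QLattice V) (x y : V) :
    L.localForm p ((1 : ℚ_[p]) ⊗ₜ[ℚ] x) ((1 : ℚ_[p]) ⊗ₜ[ℚ] y) = (L.form x y : ℚ_[p]) := by
  rw [localForm, LinearMap.BilinForm.baseChange_tmul]
  simp [Algebra.smul_def]

theorem localForm_symm (L : QLattice V) (x y : ℚ_[p] ⊗[ℚ] V) :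
    L.localForm p x y = L.localForm p y x := by
  induction x using TensorProduct.induction_on with
  | zero => simp
  | add x₁ x₂ h₁ h₂ => simp [h₁, h₂]
  | tmul a v =>
    induction y using TensorProduct.induction_on with
    | zero => simp
    | add x₁ x₂ h₁ h₂ => simp [h₁, h₂]
    | tmul a' v' =>
      simp [localForm, LinearMap.BilinForm.baseChange_tmul, L.symm v v', mul_comm]

theorem localForm_smul_left (L : QLattice V) (a : ℤ_[p]) (x y : ℚ_[p] ⊗[ℚ] V) :
    L.localForm p (a • x) y = a * L.localForm p x y := by
  rw [← algebraMap_smul ℚ_[p] a x, map_smul, LinearMap.smul_apply, smul_eq_mul]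
  rfl

theorem localForm_smul_right (L : QLattice V) (a : ℤ_[p]) (x y : ℚ_[p] ⊗[ℚ] V) :
    L.localForm p x (a • y) = a * L.localForm p x y := by
  rw [localForm_symm, localForm_smul_left, localForm_symm]

theorem localForm_of_form_eq {L M : QLattice V} {r : ℚ} (h : M.form = r • L.form)
    (x y : ℚ_[p] ⊗[ℚ] V) : M.localForm p x y = r * L.localForm p x y := by
  rw [localForm, localForm, h]
  induction x using TensorProduct.induction_on with
  | zero => simp
  | add x₁ x₂ h₁ h₂ => simp [h₁, h₂, mul_add]
  | tmul a v =>
    induction y using TensorProduct.induction_on with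
    | zero => simp
    | add x₁ x₂ h₁ h₂ => simp [h₁, h₂, mul_add]
    | tmul a' v' =>
      simp [LinearMap.BilinForm.baseChange_tmul, Algebra.smul_def]
      ring

theorem isIntegral_iff (L : QLattice V) :
    L.IsIntegral ↔ ∀ x ∈ L.lat, ∀ y ∈ L.lat, ∃ k : ℤ, L.form x y = k := by
  rw [IsIntegral, scaleIdeal, Submodule.span_le]
  constructor
  · intro h x hx y hy
    obtain ⟨k, hk⟩ := Submodule.mem_span_singleton.mp (h ⟨x, hx, y, hy, rfl⟩)
    exact ⟨k, by rw [← hk]; simp⟩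
  · rintro h _ ⟨x, hx, y, hy, rfl⟩
    obtain ⟨k, hk⟩ := h x hx y hy
    exact Submodule.mem_span_singleton.mpr ⟨k, by rw [hk]; simp⟩

theorem IsNormalized.even {L : QLattice V} (h : L.IsNormalized) {x : V} (hx : x ∈ L.lat) :
    ∃ k : ℤ, L.Q x = 2 * k := by
  have : L.Q x ∈ L.normIdeal := Submodule.subset_span ⟨x, hx, rfl⟩
  rw [h.2] at this
  obtain ⟨k, hk⟩ := Submodule.mem_span_singleton.mp this
  exact ⟨k, by rw [← hk]; simp [mul_comm]⟩

theorem localForm_integral {L : QLattice V} (h : L.IsIntegral) {x y : ℚ_[p] ⊗[ℚ] V}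
    (hx : x ∈ L.localLat p) (hy : y ∈ L.localLat p) :
    ∃ z : ℤ_[p], L.localForm p x y = z := by
  rw [isIntegral_iff] at h
  induction hx using Submodule.span_induction with
  | zero => exact ⟨0, by simp⟩
  | add x₁ x₂ _ _ h₁ h₂ =>
    obtain ⟨k, hk⟩ := h₁
    obtain ⟨l, hl⟩ := h₂
    exact ⟨k + l, by simp [hk, hl]⟩
  | smul a x _ h₁ =>
    obtain ⟨k, hk⟩ := h₁
    exact ⟨a * k, by rw [localForm_smul_left, hk, PadicInt.coe_mul]⟩
  | mem x hx =>
    obtain ⟨v, hv, rfl⟩ := hx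
    induction hy using Submodule.span_induction with
    | zero => exact ⟨0, by simp⟩
    | add x₁ x₂ _ _ h₁ h₂ =>
      obtain ⟨k, hk⟩ := h₁
      obtain ⟨l, hl⟩ := h₂
      exact ⟨k + l, by simp [hk, hl]⟩
    | smul a x _ h₁ =>
      obtain ⟨k, hk⟩ := h₁
      exact ⟨a * k, by rw [localForm_smul_right, hk, PadicInt.coe_mul]⟩
    | mem y hy =>
      obtain ⟨w, hw, rfl⟩ := hy
      obtain ⟨k, hk⟩ := h v hv w hw
      exact ⟨k, by simp [localForm_tmul, hk]⟩

theorem IsNormalized.localForm_even {L : QLattice V} (h : L.IsNormalized) {x : ℚ_[p] ⊗[ℚ] V}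
    (hx : x ∈ L.localLat p) : ∃ z : ℤ_[p], L.localForm p x x = 2 * z := by
  induction hx using Submodule.span_induction with
  | zero => exact ⟨0, by simp⟩
  | add x₁ x₂ hx₁ hx₂ h₁ h₂ =>
    obtain ⟨k, hk⟩ := h₁
    obtain ⟨l, hl⟩ := h₂
    obtain ⟨t, ht⟩ := localForm_integral p h.1 hx₁ hx₂
    refine ⟨k + l + t, ?_⟩
    simp only [map_add, LinearMap.add_apply, localForm_symm p L x₂ x₁, hk, hl, ht]
    push_cast
    ring
  | smul a x _ h₁ =>
    obtain ⟨k, hk⟩ := h₁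
    refine ⟨a * a * k, ?_⟩
    rw [localForm_smul_left, localForm_smul_right, hk]
    push_cast
    ring
  | mem x hx =>
    obtain ⟨v, hv, rfl⟩ := hx
    obtain ⟨k, hk⟩ := h.even hv
    refine ⟨k, ?_⟩
    rw [localForm_tmul]
    rw [Q] at hk
    rw [hk]
    push_cast
    rfl

/-- Lattices that agree up to powers of `p` have the same localization at a prime `q ≠ p`. -/
theorem localLat_eq_of_ne {q : ℕ} [Fact q.Prime] (hq : q ≠ p) {L M : QLattice V} {m : ℕ}
    (hle : M.lat ≤ L.lat) (hm : ∀ x ∈ L.lat, (p ^ m : ℤ) • x ∈ M.lat) :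
    M.localLat q = L.localLat q := by
  refine le_antisymm (localLat_mono q hle) (Submodule.span_le.mpr ?_)
  rintro _ ⟨v, hv, rfl⟩
  have hu : IsUnit ((p : ℤ_[q]) ^ m) := by
    refine IsUnit.pow _ ?_
    rw [PadicInt.isUnit_iff, PadicInt.norm_natCast_eq_one_iff]
    exact (Nat.coprime_primes Fact.out Fact.out).mpr hq
  have h := Submodule.smul_mem (M.localLat q) (hu.unit⁻¹ : ℤ_[q]ˣ).1
    (tmul_mem_localLat q (hm v hv))
  have h2 : (1 : ℚ_[q]) ⊗ₜ[ℚ] ((p ^ m : ℤ) • v) = ((p : ℤ_[q]) ^ m) • (1 : ℚ_[q]) ⊗ₜ[ℚ] v := by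
    rw [TensorProduct.tmul_smul, ← Int.cast_smul_eq_zsmul ℤ_[q]]
    push_cast
    rfl
  rw [h2, smul_smul, hu.val_inv_mul, one_smul] at h
  exact h

end Local

/-! ### Primitive representations as pullbacks -/

theorem fg_of_map_le {X Y : Type*} [AddCommGroup X] [AddCommGroup Y] {f : X →ₗ[ℤ] Y}
    (hf : Function.Injective f) {A : Submodule ℤ X} {B : Submodule ℤ Y} (hB : B.FG)
    (h : A.map f ≤ B) : A.FG := by
  have : IsNoetherian ℤ B := isNoetherian_of_fg_of_noetherian B hB
  refine Submodule.fg_of_fg_map_injective f hf ?_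
  have h2 := (IsNoetherian.noetherian ((A.map f).comap B.subtype)).map B.subtype
  rwa [Submodule.map_comap_subtype, inf_eq_right.mpr h] at h2

theorem exists_zsmul_mem (L : QLattice V) (x : V) : ∃ d : ℤ, d ≠ 0 ∧ d • x ∈ L.lat := by
  have hx : x ∈ Submodule.span ℚ (L.lat : Set V) := by rw [L.full]; trivial
  induction hx using Submodule.span_induction with
  | mem y hy => exact ⟨1, one_ne_zero, by simpa using hy⟩
  | zero => exact ⟨1, one_ne_zero, by simp⟩
  | add y z _ _ hy hz =>
    obtain ⟨d, hd, h⟩ := hy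
    obtain ⟨e, he, h'⟩ := hz
    refine ⟨d * e, mul_ne_zero hd he, ?_⟩
    rw [smul_add]
    refine L.lat.add_mem ?_ ?_
    · rw [mul_comm, mul_smul]
      exact L.lat.smul_mem _ h
    · rw [mul_smul]
      exact L.lat.smul_mem _ h'
  | smul a y _ hy =>
    obtain ⟨d, hd, h⟩ := hy
    refine ⟨d * a.den, mul_ne_zero hd (by exact_mod_cast a.den_nz), ?_⟩
    have : (d * a.den : ℤ) • a • y = a.num • d • y := by
      rw [← Int.cast_smul_eq_zsmul ℚ, ← Int.cast_smul_eq_zsmul ℚ, ← Int.cast_smul_eq_zsmul ℚ,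
        smul_smul, smul_smul]
      congr 1
      push_cast
      linear_combination (d : ℚ) * Rat.den_mul_eq_num a
    rw [this]
    exact L.lat.smul_mem _ h

theorem injective_of_isometry {N : QLattice W} {L : QLattice V} {σ : W →ₗ[ℚ] V}
    (hσ : ∀ x y, L.form (σ x) (σ y) = N.form x y) : Function.Injective σ := by
  rw [injective_iff_map_eq_zero]
  intro x hx
  by_contra hne
  have := N.pos x hne
  rw [← hσ, hx] at this
  simp at this

/-- A direct summand is the same as a saturated sublattice: modulo the image of `σ`, `L` becomes
finitely generated and torsion-free, hence free, so the projection splits. The pullback form is the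
one that survives passing to sublattices. -/
theorem primitivelyRepresentedBy_iff {N : QLattice W} {L : QLattice V} :
    N.PrimitivelyRepresentedBy L ↔ ∃ σ : W →ₗ[ℚ] V,
      (∀ x y, L.form (σ x) (σ y) = N.form x y) ∧ ∀ w, w ∈ N.lat ↔ σ w ∈ L.lat := by
  have : IsAddTorsionFree V := IsAddTorsionFree.of_module_rat V
  constructor
  · rintro ⟨σ, hσ, C, hd, hs⟩
    have hle : ∀ w ∈ N.lat, σ w ∈ L.lat := fun w hw =>
      hs.le (Submodule.mem_sup_left ⟨w, hw, rfl⟩)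
    refine ⟨σ, hσ, fun w => ⟨hle w, fun hw => ?_⟩⟩
    rw [← hs] at hw
    obtain ⟨_, ⟨v, hv, rfl⟩, c, hc, hvc⟩ := Submodule.mem_sup.mp hw
    -- A priori `w` lies only in the space of `N`; a nonzero multiple lies in `N`, which puts `d •
    -- c` into both summands.
    obtain ⟨d, hd0, hdw⟩ := N.exists_zsmul_mem w
    have hdc : d • c = σ (d • w - d • v) := by
      rw [map_sub, map_zsmul, map_zsmul, ← hvc]
      simp
    have h0 : d • c = 0 := (Submodule.disjoint_def.mp hd) _
      (hdc ▸ ⟨_, N.lat.sub_mem hdw (N.lat.smul_mem d hv), rfl⟩) (C.smul_mem d hc)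
    have hc0 : c = 0 := (smul_eq_zero.mp h0).resolve_left hd0
    have : v = w := injective_of_isometry hσ (by simpa [hc0] using hvc)
    exact this ▸ hv
  · rintro ⟨σ, hσ, h⟩
    let g : L.lat →ₗ[ℤ] (V ⧸ LinearMap.range σ) :=
      ((LinearMap.range σ).mkQ.restrictScalars ℤ).comp L.lat.subtype
    have hfin : Module.Finite ℤ L.lat := Module.Finite.iff_fg.mpr L.fg
    have : IsAddTorsionFree (V ⧸ LinearMap.range σ) := IsAddTorsionFree.of_module_rat _
    have : Module.Free ℤ (LinearMap.range g) := Module.free_of_finite_type_torsion_free'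
    obtain ⟨s, hs⟩ := g.rangeRestrict.exists_rightInverse_of_surjective g.range_rangeRestrict
    have hs' : ∀ y, g (s y) = y := fun y => congrArg Subtype.val (LinearMap.congr_fun hs y)
    have hker : ∀ x : L.lat, g x = 0 ↔ (x : V) ∈ N.lat.map (σ.restrictScalars ℤ) := by
      intro x
      have : g x = (LinearMap.range σ).mkQ (x : V) := rfl
      rw [this, Submodule.mkQ_apply, Submodule.Quotient.mk_eq_zero]
      constructor
      · rintro ⟨w, hw⟩
        exact ⟨w, (h w).mpr (hw ▸ x.2), hw⟩
      · rintro ⟨w, -, hw⟩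
        exact ⟨w, hw⟩
    refine ⟨σ, hσ, (LinearMap.range s).map L.lat.subtype, ?_, le_antisymm (sup_le ?_ ?_) ?_⟩
    · rw [Submodule.disjoint_def]
      rintro _ h1 ⟨_, ⟨y, rfl⟩, rfl⟩
      have h2 := (hker (s y)).mpr h1
      rw [hs'] at h2
      have : y = 0 := Subtype.ext h2
      simp [this]
    · rintro _ ⟨w, hw, rfl⟩
      exact (h w).mp hw
    · rintro _ ⟨x, -, rfl⟩
      exact x.2
    · intro x hx
      have h1 := hs' (g.rangeRestrict ⟨x, hx⟩)
      rw [← sub_add_cancel x (s (g.rangeRestrict ⟨x, hx⟩) : V)]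
      refine Submodule.add_mem_sup ?_ ⟨_, ⟨_, rfl⟩, rfl⟩
      refine (hker (⟨x, hx⟩ - s (g.rangeRestrict ⟨x, hx⟩))).mp ?_
      rw [map_sub, h1]
      simp

/-! ### The genus -/

theorem exists_int_of_forall_padic {a : ℚ}
    (h : ∀ (q : ℕ) [Fact q.Prime], ∃ z : ℤ_[q], (a : ℚ_[q]) = z) : ∃ k : ℤ, a = k := by
  suffices a.den = 1 from ⟨a.num, (Rat.den_eq_one_iff a).mp this |>.symm⟩
  by_contra hne
  obtain ⟨q, hq, hdvd⟩ := Nat.exists_prime_and_dvd hne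
  have : Fact q.Prime := ⟨hq⟩
  obtain ⟨z, hz⟩ := h q
  obtain ⟨c, hc⟩ := id hdvd
  have h2 : ((a.num : ℤ) : ℚ_[q]) = (q : ℚ_[q]) ^ 1 * (c * z : ℤ_[q]) := by
    have h3 : (a.den : ℚ_[q]) * a = a.num := by exact_mod_cast Rat.den_mul_eq_num a
    rw [← h3, hz, hc]
    push_cast
    ring
  obtain ⟨l, hl⟩ := intCast_eq_mul_of_padic q h2
  have h4 : q ∣ a.num.natAbs := Int.natCast_dvd.mp ⟨l, by simpa using hl⟩
  have := Nat.dvd_gcd h4 hdvd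
  rw [a.reduced] at this
  exact hq.one_lt.ne' (Nat.dvd_one.mp this)

theorem InGenus.isIntegral {K : QLattice W} {L : QLattice V} (h : K.InGenus L)
    (hL : L.IsIntegral) : K.IsIntegral := by
  rw [isIntegral_iff]
  intro x hx y hy
  refine exists_int_of_forall_padic fun q _ => ?_
  obtain ⟨σ, hσ, hσ'⟩ := h q
  obtain ⟨x', hx', hxx'⟩ := hσ'.ge (tmul_mem_localLat q hx)
  obtain ⟨y', hy', hyy'⟩ := hσ'.ge (tmul_mem_localLat q hy)
  obtain ⟨z, hz⟩ := localForm_integral q hL hx' hy'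
  refine ⟨z, ?_⟩
  rw [← localForm_tmul, ← hxx', ← hyy', hσ, hz, one_mul]

/-! ### Sublattices cut out by a divisibility condition on `Q` -/

section Sublattice

variable (p : ℕ) [Fact p.Prime] {L L' : QLattice V}

/-- On an even lattice `Q (v + p w) ≡ Q v` modulo `2p`, so the condition depends only on the class
modulo `p`, and every class of `L_p` is met by `L`. -/
theorem mem_localLat_sublattice_iff (hL : L.IsNormalized)
    (hlat : ∀ x, x ∈ L'.lat ↔ x ∈ L.lat ∧ ∃ z : ℤ_[p], (L.Q x : ℚ_[p]) = 2 * p * z)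
    (hp : ∀ x ∈ L.lat, (p : ℤ) • x ∈ L'.lat) {y : ℚ_[p] ⊗[ℚ] V} :
    y ∈ L'.localLat p ↔
      y ∈ L.localLat p ∧ ∃ z : ℤ_[p], L.localForm p y y = 2 * p * z := by
  have hle : L'.localLat p ≤ L.localLat p := localLat_mono p fun x hx => ((hlat x).mp hx).1
  have key : ∀ (v : V) (w : ℚ_[p] ⊗[ℚ] V), v ∈ L.lat → w ∈ L.localLat p →
      ∃ z : ℤ_[p], L.localForm p ((1 : ℚ_[p]) ⊗ₜ[ℚ] v + (p : ℤ_[p]) • w)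
        ((1 : ℚ_[p]) ⊗ₜ[ℚ] v + (p : ℤ_[p]) • w) = L.Q v + 2 * p * z := by
    intro v w hv hw
    obtain ⟨s, hs⟩ := localForm_integral p hL.1 (tmul_mem_localLat p hv) hw
    obtain ⟨t, ht⟩ := hL.localForm_even p hw
    refine ⟨s + p * t, ?_⟩
    simp only [map_add, LinearMap.add_apply, localForm_smul_left, localForm_smul_right, hs, ht,
      localForm_symm p L w, localForm_tmul, Q]
    push_cast
    ring
  constructor
  · intro hy
    refine ⟨hle hy, ?_⟩
    obtain ⟨v, hv, w, hw, rfl⟩ := exists_approx p hy 1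
    obtain ⟨z, hz⟩ := key v w ((hlat v).mp hv).1 (hle hw)
    obtain ⟨z', hz'⟩ := ((hlat v).mp hv).2
    refine ⟨z' + z, ?_⟩
    rw [pow_one, hz, hz']
    push_cast
    ring
  · rintro ⟨hy, z', hz'⟩
    obtain ⟨v, hv, w, hw, rfl⟩ := exists_approx p hy 1
    obtain ⟨z, hz⟩ := key v w hv hw
    rw [pow_one] at hz' ⊢
    refine Submodule.add_mem _ (tmul_mem_localLat p ((hlat v).mpr ⟨hv, z' - z, ?_⟩)) ?_
    · rw [hz] at hz'
      push_cast
      linear_combination hz'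
    · clear hz hz' hy
      induction hw using Submodule.span_induction with
      | mem y hy =>
        obtain ⟨v, hv, rfl⟩ := hy
        have := tmul_mem_localLat p (hp v hv)
        rw [TensorProduct.tmul_smul, ← Int.cast_smul_eq_zsmul ℤ_[p]] at this
        exact_mod_cast this
      | zero => simp
      | add y z _ _ hy hz =>
        rw [smul_add]
        exact Submodule.add_mem _ hy hz
      | smul a y _ hy =>
        rw [smul_comm]
        exact Submodule.smul_mem _ _ hy

/-- A lattice in the genus of `L' ⊆ L` is contained, in the same way, in a lattice in the genus
of `L`. -/
theorem exists_inGenus_of_sublattice {r : ℚ} (hr : 0 < r) (hL : L.IsNormalized)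
    (hform : L'.form = r • L.form)
    (hlat : ∀ x, x ∈ L'.lat ↔ x ∈ L.lat ∧ ∃ z : ℤ_[p], (L.Q x : ℚ_[p]) = 2 * p * z)
    (hp : ∀ x ∈ L.lat, (p : ℤ) • x ∈ L'.lat) {K' : QLattice W} (hK' : K'.InGenus L') :
    ∃ K : QLattice W, K.InGenus L ∧ K.form = r⁻¹ • K'.form ∧
      ∀ x, x ∈ K'.lat ↔ x ∈ K.lat ∧ ∃ z : ℤ_[p], (K.Q x : ℚ_[p]) = 2 * p * z := by
  have hp0 : (p : ℤ) ≠ 0 := by exact_mod_cast (Fact.out : p.Prime).ne_zero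
  have hmem := fun y => mem_localLat_sublattice_iff p hL hlat hp (y := y)
  obtain ⟨σ, hσ, hσ'⟩ := hK' p
  have hK'p : ∀ y, y ∈ K'.localLat p ↔ σ.symm y ∈ L'.localLat p := by
    intro y
    rw [← SetLike.mem_coe, ← hσ']
    constructor
    · rintro ⟨x, hx, rfl⟩
      simpa using hx
    · intro hy
      exact ⟨_, hy, by simp⟩
  have hle : L'.localLat p ≤ L.localLat p := localLat_mono p fun x hx => ((hlat x).mp hx).1
  -- The lattice that agrees with `K'` away from `p` and has localization `σ(L_p)` at `p`. As `pL_p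
  -- ⊆ L'_p`, it lies in `p⁻¹K'`.
  let A : Submodule ℤ W := (K'.lat.comap ((p : ℤ) • LinearMap.id)) ⊓
    (((L.localLat p).restrictScalars ℤ).comap ((σ.symm.toLinearMap.restrictScalars ℤ).comp
      ((TensorProduct.mk ℚ ℚ_[p] W 1).restrictScalars ℤ)))
  have hA : ∀ x, x ∈ A ↔ (p : ℤ) • x ∈ K'.lat ∧
      σ.symm ((1 : ℚ_[p]) ⊗ₜ[ℚ] x) ∈ L.localLat p := fun x => Iff.rfl
  have hK'A : K'.lat ≤ A := fun x hx => (hA x).mpr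
    ⟨K'.lat.smul_mem _ hx, hle ((hK'p _).mp (tmul_mem_localLat p hx))⟩
  have : IsAddTorsionFree W := IsAddTorsionFree.of_module_rat W
  let K : QLattice W :=
    { form := r⁻¹ • K'.form
      symm := fun x y => by simp [K'.symm x y]
      pos := fun x hx => by simpa using mul_pos (inv_pos.mpr hr) (K'.pos x hx)
      lat := A
      fg := by
        refine fg_of_map_le (f := (p : ℤ) • LinearMap.id) (fun x y h => ?_) K'.fg ?_
        · exact smul_right_injective W hp0 h
        · rintro _ ⟨x, hx, rfl⟩
          exact ((hA x).mp hx).1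
      full := by
        rw [eq_top_iff, ← K'.full]
        exact Submodule.span_mono hK'A }
  have hKform : K.form = r⁻¹ • K'.form := rfl
  have hKlat : K.lat = A := rfl
  have hKp : ∀ y, y ∈ K.localLat p ↔ σ.symm y ∈ L.localLat p := by
    intro y
    constructor
    · intro hy
      induction hy using Submodule.span_induction with
      | mem y hy =>
        obtain ⟨v, hv, rfl⟩ := hy
        exact ((hA v).mp hv).2
      | zero => simp
      | add y z _ _ hy hz =>
        rw [map_add]
        exact Submodule.add_mem _ hy hz
      | smul a y _ hy =>
        rw [← algebraMap_smul ℚ_[p] a y, map_smul, algebraMap_smul]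
        exact Submodule.smul_mem _ _ hy
    · intro hy
      have h1 : (p : ℤ_[p]) • y ∈ K'.localLat p := by
        rw [hK'p, ← algebraMap_smul ℚ_[p] _ y, map_smul, algebraMap_smul, hmem]
        refine ⟨Submodule.smul_mem _ _ hy, ?_⟩
        obtain ⟨t, ht⟩ := hL.localForm_even p hy
        refine ⟨p * t, ?_⟩
        rw [localForm_smul_left, localForm_smul_right, ht]
        push_cast
        ring
      -- Approximating `p y` by `z ∈ K'` modulo `p` gives `y = p⁻¹z + w` with `w ∈ K'_p`, so that
      -- `p⁻¹z` is a global vector lying in `A`.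
      obtain ⟨z, hz, w, hw, hzw⟩ := exists_approx p h1 1
      have hpQ : (p : ℚ) ≠ 0 := by exact_mod_cast hp0
      have hpK : (p : ℚ_[p]) ≠ 0 := by exact_mod_cast hp0
      have hzx : z = (p : ℤ) • (p : ℚ)⁻¹ • z := by
        rw [← Int.cast_smul_eq_zsmul ℚ, smul_smul, Int.cast_natCast, mul_inv_cancel₀ hpQ, one_smul]
      have hy' : y = (1 : ℚ_[p]) ⊗ₜ[ℚ] ((p : ℚ)⁻¹ • z) + w := by
        have h2 : (p : ℚ_[p]) • y =
            (p : ℚ_[p]) • ((1 : ℚ_[p]) ⊗ₜ[ℚ] ((p : ℚ)⁻¹ • z) + w) := by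
          have h3 : ∀ u : ℚ_[p] ⊗[ℚ] W, (p : ℤ_[p]) • u = (p : ℚ_[p]) • u := fun u => by
            rw [← algebraMap_smul ℚ_[p] (p : ℤ_[p]) u]
            simp
          rw [pow_one, h3, h3] at hzw
          rw [hzw, smul_add]
          congr 1
          nth_rewrite 1 [hzx]
          rw [TensorProduct.tmul_smul, ← Int.cast_smul_eq_zsmul ℚ_[p]]
          push_cast
          rfl
        exact smul_right_injective _ hpK h2
      have hw2 : w ∈ K.localLat p := localLat_mono p (L := K') (M := K) hK'A hw
      have hw3 : σ.symm w ∈ L.localLat p := hle ((hK'p w).mp hw)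
      rw [hy']
      refine Submodule.add_mem _ (tmul_mem_localLat p ((hA _).mpr ⟨hzx ▸ hz, ?_⟩)) hw2
      have h5 : (1 : ℚ_[p]) ⊗ₜ[ℚ] ((p : ℚ)⁻¹ • z) = y - w := by rw [hy', add_sub_cancel_right]
      rw [h5, map_sub]
      exact Submodule.sub_mem _ hy hw3
  have hscale : ∀ (q : ℕ) [Fact q.Prime] (τ : (ℚ_[q] ⊗[ℚ] V) ≃ₗ[ℚ_[q]] (ℚ_[q] ⊗[ℚ] W)),
      (∀ x y, K'.localForm q (τ x) (τ y) = 1 * L'.localForm q x y) →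
      ∀ x y, K.localForm q (τ x) (τ y) = 1 * L.localForm q x y := by
    intro q _ τ hτ x y
    have hr0 : (r : ℚ_[q]) ≠ 0 := by exact_mod_cast hr.ne'
    rw [localForm_of_form_eq q hKform, hτ, localForm_of_form_eq q hform]
    push_cast
    field_simp
  refine ⟨K, ?_, hKform, ?_⟩
  · intro q hq
    by_cases hqp : q = p
    · subst hqp
      refine ⟨σ, hscale _ σ hσ, ?_⟩
      ext y
      rw [SetLike.mem_coe, hKp]
      constructor
      · rintro ⟨x, hx, rfl⟩
        simpa using hx
      · intro hy
        exact ⟨_, hy, by simp⟩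
    · obtain ⟨τ, hτ, hτ'⟩ := hK' q
      refine ⟨τ, hscale q τ hτ, ?_⟩
      rw [← localLat_eq_of_ne p hqp (L := L) (M := L') (m := 1)
        (fun x hx => ((hlat x).mp hx).1) (by simpa using hp), hτ',
        localLat_eq_of_ne p hqp (L := K) (M := K') (m := 1) hK'A
          (fun x hx => by simpa using ((hA x).mp hx).1)]
  · intro x
    have hval : (K.Q x : ℚ_[p]) =
        L.localForm p (σ.symm ((1 : ℚ_[p]) ⊗ₜ[ℚ] x)) (σ.symm ((1 : ℚ_[p]) ⊗ₜ[ℚ] x)) := by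
      have := hscale p σ hσ (σ.symm ((1 : ℚ_[p]) ⊗ₜ[ℚ] x)) (σ.symm ((1 : ℚ_[p]) ⊗ₜ[ℚ] x))
      rw [LinearEquiv.apply_symm_apply, localForm_tmul, one_mul] at this
      exact this
    rw [hval]
    constructor
    · intro hx
      exact ⟨hK'A hx, ((hmem _).mp ((hK'p _).mp (tmul_mem_localLat p hx))).2⟩
    · rintro ⟨hx, hz⟩
      obtain ⟨h1, h2⟩ := (hA x).mp hx
      refine mem_lat_of_local p (m := 1) (by simpa using h1) ?_
      rw [hK'p, hmem]
      exact ⟨h2, hz⟩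

/-- Strict regularity passes to the sublattice of the `x` with `Q x ∈ 2pℤ_p`. -/
theorem IsStrictlyRegular.sublattice {n : ℕ} {r : ℚ} (hr : 0 < r) (hL : L.IsNormalized)
    (hreg : L.IsStrictlyRegular n) (hform : L'.form = r • L.form)
    (hlat : ∀ x, x ∈ L'.lat ↔ x ∈ L.lat ∧ ∃ z : ℤ_[p], (L.Q x : ℚ_[p]) = 2 * p * z)
    (hp : ∀ x ∈ L.lat, (p : ℤ) • x ∈ L'.lat) : L'.IsStrictlyRegular n := by
  rintro W _ _ N - hrank ⟨U, _, _, K', hK', hNK'⟩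
  obtain ⟨K, hK, hKform, hKlat⟩ := exists_inGenus_of_sublattice p hr hL hform hlat hp hK'
  obtain ⟨σ, hσ, hσ'⟩ := primitivelyRepresentedBy_iff.mp hNK'
  have hinj := injective_of_isometry hσ
  have hNK : ∀ w ∈ N.lat, σ w ∈ K.lat := fun w hw => ((hKlat _).mp ((hσ' w).mp hw)).1
  -- The saturation of `N` inside `K`: primitive in `K` by construction, and `N` is recovered from
  -- it by the condition on `Q`.
  let N' : QLattice W :=
    { form := r⁻¹ • N.form
      symm := fun x y => by simp [N.symm x y]
      pos := fun x hx => by simpa using mul_pos (inv_pos.mpr hr) (N.pos x hx)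
      lat := K.lat.comap (σ.restrictScalars ℤ)
      fg := fg_of_map_le (f := σ.restrictScalars ℤ) hinj K.fg (Submodule.map_comap_le _ _)
      full := by
        rw [eq_top_iff, ← N.full]
        exact Submodule.span_mono hNK }
  have hσN' : ∀ x y, K.form (σ x) (σ y) = N'.form x y := by
    intro x y
    rw [hKform]
    simp only [N', LinearMap.smul_apply, hσ]
  have hint : N'.IsIntegral := by
    have := (isIntegral_iff K).mp (hK.isIntegral hL.1)
    rw [isIntegral_iff]
    intro x hx y hy
    rw [← hσN']
    exact this _ hx _ hy
  obtain ⟨τ, hτ, hτ'⟩ := primitivelyRepresentedBy_iff.mp (hreg W N' hint hrank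
    ⟨U, _, _, K, hK, primitivelyRepresentedBy_iff.mpr ⟨σ, hσN', fun _ => Iff.rfl⟩⟩)
  refine primitivelyRepresentedBy_iff.mpr ⟨τ, fun x y => ?_, fun w => ?_⟩
  · rw [hform, LinearMap.smul_apply, LinearMap.smul_apply, hτ]
    simp only [N', LinearMap.smul_apply, smul_eq_mul]
    field_simp
  -- Membership in `K` and in `L` both cut out `N'`, and `σ`, `τ` give `w` the same value of `Q`; so
  -- the condition defining `K'` matches the one defining `L'`.
  · rw [hσ', hKlat, hlat, ← hτ']
    have : K.Q (σ w) = L.Q (τ w) := by rw [Q, Q, hσN', hτ]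
    rw [this]
    rfl

end Sublattice

/-! ### Quadratic forms over finite fields and `p`-adic integers -/

section Hensel

/-- In characteristic 2 Euler's identity says nothing; but the only anisotropic binary form over
`𝔽_2` is `x² + xy + y²`. -/
theorem partial_ne_zero_of_anisotropic_binary_two : ∀ a b c : ZMod 2,
    (∀ x y : ZMod 2, a * x ^ 2 + b * x * y + c * y ^ 2 = 0 → x = 0 ∧ y = 0) →
      ∀ x y : ZMod 2, a * x ^ 2 + b * x * y + c * y ^ 2 ≠ 0 →
        2 * a * x + b * y ≠ 0 ∨ b * x + 2 * c * y ≠ 0 := by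
  decide

variable (p : ℕ) [Fact p.Prime]

/-- Hensel's lemma at `0`, where the derivative is the unit `b`. That `t` is small matters later, to
keep perturbed units units. -/
theorem exists_root_quadratic {a b c : ℤ_[p]} (hb : IsUnit b) (hc : ‖c‖ < 1) :
    ∃ t : ℤ_[p], ‖t‖ < 1 ∧ a * t ^ 2 + b * t + c = 0 := by
  open Polynomial in
  have hb' : ‖b‖ = 1 := PadicInt.isUnit_iff.mp hb
  let F : ℤ_[p][X] := C a * X ^ 2 + C b * X + C c
  have h0 : F.aeval (0 : ℤ_[p]) = c := by simp [F]
  have h1 : F.derivative.aeval (0 : ℤ_[p]) = b := by simp [F]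
  obtain ⟨t, ht, ht', -⟩ := hensels_lemma (F := F) (a := 0) (by rw [h0, h1, hb']; simpa using hc)
  rw [h1, hb', sub_zero] at ht'
  refine ⟨t, ht', ?_⟩
  simpa [F] using ht

/-- Chevalley–Warning: the degree 2 is less than the number of variables, so `p` divides the number
of zeros, and `0` is not the only one. -/
theorem exists_isotropic_of_fin_three (c : Fin 3 → Fin 3 → ZMod p) :
    ∃ v : Fin 3 → ZMod p, v ≠ 0 ∧ ∑ i, ∑ j, c i j * (v i * v j) = 0 := by
  open MvPolynomial in
  let f : MvPolynomial (Fin 3) (ZMod p) := ∑ i, ∑ j, C (c i j) * (X i * X j)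
  have hf : ∀ v, eval v f = ∑ i, ∑ j, c i j * (v i * v j) := fun v => by simp [f]
  have h0 : eval (0 : Fin 3 → ZMod p) f = 0 := by rw [hf]; simp
  have hdeg : f.totalDegree < Fintype.card (Fin 3) := by
    refine lt_of_le_of_lt (b := 2) ?_ (by simp)
    refine totalDegree_finsetSum_le fun i _ => totalDegree_finsetSum_le fun j _ => ?_
    refine (totalDegree_mul _ _).trans ?_
    rw [totalDegree_C, zero_add]
    refine (totalDegree_mul _ _).trans ?_
    rw [totalDegree_X, totalDegree_X]
  have hdvd := char_dvd_card_solutions p hdeg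
  have hpos : 0 < Fintype.card { x : Fin 3 → ZMod p // eval x f = 0 } :=
    Fintype.card_pos_iff.mpr ⟨⟨0, h0⟩⟩
  have h1 := (Fact.out : p.Prime).one_lt.trans_le (Nat.le_of_dvd hpos hdvd)
  obtain ⟨⟨v, hv⟩, hne⟩ := Fintype.exists_ne_of_one_lt_card h1 ⟨0, h0⟩
  exact ⟨v, fun h => hne (Subtype.ext h), by rw [← hf, hv]⟩

section Binary

variable {p} {a b c : ZMod p}

/-- The ternary form obtained by subtracting `w z²` has a nontrivial zero; anisotropy forces `z ≠
0`, and one divides by `z`. -/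
theorem exists_eq_of_anisotropic_binary
    (h : ∀ x y : ZMod p, a * x ^ 2 + b * x * y + c * y ^ 2 = 0 → x = 0 ∧ y = 0) (w : ZMod p) :
    ∃ x y, a * x ^ 2 + b * x * y + c * y ^ 2 = w := by
  obtain ⟨v, hv, hv0⟩ := exists_isotropic_of_fin_three p ![![a, b, 0], ![0, c, 0], ![0, 0, -w]]
  simp only [Fin.sum_univ_three, Matrix.cons_val_zero, Matrix.cons_val_one, Matrix.cons_val] at hv0
  by_cases h2 : v 2 = 0
  · exfalso
    have h01 := h (v 0) (v 1) (by rw [h2] at hv0; linear_combination hv0)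
    apply hv
    funext i
    fin_cases i
    · exact h01.1
    · exact h01.2
    · exact h2
  · refine ⟨v 0 / v 2, v 1 / v 2, ?_⟩
    field_simp
    linear_combination hv0

/-- An anisotropic binary form has no singular nonzero points. -/
theorem partial_ne_zero_of_anisotropic_binary
    (h : ∀ x y : ZMod p, a * x ^ 2 + b * x * y + c * y ^ 2 = 0 → x = 0 ∧ y = 0) {x y : ZMod p}
    (hxy : a * x ^ 2 + b * x * y + c * y ^ 2 ≠ 0) :
    2 * a * x + b * y ≠ 0 ∨ b * x + 2 * c * y ≠ 0 := by
  by_contra! hcon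
  have h1 := hcon.1
  have h2 := hcon.2
  -- Euler's identity for a form of degree 2; it leaves only the characteristic 2.
  have h3 : (2 : ZMod p) * (a * x ^ 2 + b * x * y + c * y ^ 2) = 0 := by
    linear_combination x * h1 + y * h2
  have h4 : (2 : ZMod p) = 0 := (mul_eq_zero.mp h3).resolve_right hxy
  have h5 : p = 2 := by
    have : ((2 : ℕ) : ZMod p) = 0 := by exact_mod_cast h4
    rw [ZMod.natCast_eq_zero_iff] at this
    exact (Nat.prime_dvd_prime_iff_eq Fact.out Nat.prime_two).mp this
  subst h5
  exact (partial_ne_zero_of_anisotropic_binary_two a b c h x y hxy).elim (fun h => h hcon.1) (fun h => h hcon.2)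

end Binary

/-- An integral binary form that is anisotropic modulo `p` represents all `p`-adic units. -/
theorem exists_eq_unit_of_anisotropic_binary {a b c : ℤ}
    (h : ∀ x y : ℤ, (p : ℤ) ∣ a * x ^ 2 + b * x * y + c * y ^ 2 → (p : ℤ) ∣ x ∧ (p : ℤ) ∣ y)
    {u : ℤ_[p]} (hu : IsUnit u) :
    ∃ x y : ℤ_[p], a * x ^ 2 + b * x * y + c * y ^ 2 = u := by
  have h' : ∀ x y : ZMod p, (a : ZMod p) * x ^ 2 + b * x * y + c * y ^ 2 = 0 →
      x = 0 ∧ y = 0 := by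
    intro x y hxy
    obtain ⟨x, rfl⟩ := ZMod.intCast_surjective x
    obtain ⟨y, rfl⟩ := ZMod.intCast_surjective y
    rw [ZMod.intCast_zmod_eq_zero_iff_dvd, ZMod.intCast_zmod_eq_zero_iff_dvd]
    refine h x y ?_
    rw [← ZMod.intCast_zmod_eq_zero_iff_dvd]
    push_cast
    exact hxy
  obtain ⟨x, y, hxy⟩ := exists_eq_of_anisotropic_binary h' (PadicInt.toZMod u)
  have h2z : PadicInt.toZMod (2 : ℤ_[p]) = 2 := map_ofNat _ 2
  have hne : PadicInt.toZMod u ≠ 0 := (hu.map PadicInt.toZMod).ne_zero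
  obtain ⟨x, rfl⟩ := ZMod.intCast_surjective x
  obtain ⟨y, rfl⟩ := ZMod.intCast_surjective y
  have hsmall : ∀ z : ℤ_[p], PadicInt.toZMod z = 0 → ‖z‖ < 1 := by
    intro z hz
    rw [← RingHom.mem_ker, PadicInt.ker_toZMod, IsLocalRing.mem_maximalIdeal,
      PadicInt.mem_nonunits] at hz
    exact hz
  have hunit : ∀ z : ℤ_[p], PadicInt.toZMod z ≠ 0 → IsUnit z := by
    intro z hz
    by_contra hcon
    apply hz
    rw [← RingHom.mem_ker, PadicInt.ker_toZMod, IsLocalRing.mem_maximalIdeal]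
    exact hcon
  have hc : ‖(a * x ^ 2 + b * x * y + c * y ^ 2 - u : ℤ_[p])‖ < 1 :=
    hsmall _ (by simp [hxy])
  -- A nonvanishing partial derivative lets Hensel's lemma correct that variable while the other
  -- stays fixed.
  rcases partial_ne_zero_of_anisotropic_binary h' (hxy ▸ hne) with h1 | h1
  · obtain ⟨t, -, ht⟩ := exists_root_quadratic p (a := a) (b := 2 * a * x + b * y)
      (hunit _ (by simpa [h2z] using h1)) hc
    exact ⟨x + t, y, by linear_combination ht⟩
  · obtain ⟨t, -, ht⟩ := exists_root_quadratic p (a := c) (b := b * x + 2 * c * y)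
      (hunit _ (by simpa [h2z] using h1)) hc
    exact ⟨x, y + t, by linear_combination ht⟩

end Hensel

/-! ### Dimensions modulo `p` -/

section Dimension

variable (p : ℕ) [Fact p.Prime] {A E : Type*} [AddCommGroup A] [AddCommGroup E]
  [Module (ZMod p) E] (π : A →+ E)

/-- Turns independence over `𝔽_p` into a divisibility statement about integer combinations, to which
values of `Q` can be compared. -/
theorem linearIndependent_comp_iff {n : ℕ} (x : Fin n → A) :
    LinearIndependent (ZMod p) (fun i => π (x i)) ↔
      ∀ a : Fin n → ℤ, π (∑ i, a i • x i) = 0 → ∀ i, (p : ℤ) ∣ a i := by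
  have hsum : ∀ a : Fin n → ℤ, ∑ i, (a i : ZMod p) • π (x i) = π (∑ i, a i • x i) := fun a => by
    simp [map_sum, Int.cast_smul_eq_zsmul]
  rw [Fintype.linearIndependent_iff]
  constructor
  · intro h a ha i
    rw [← ZMod.intCast_zmod_eq_zero_iff_dvd]
    exact h (fun i => (a i : ZMod p)) ((hsum a).trans ha) i
  · intro h g hg i
    choose a ha using fun i => ZMod.intCast_surjective (g i)
    rw [← ha i, ZMod.intCast_zmod_eq_zero_iff_dvd]
    refine h a ?_ i
    rw [← hsum]
    simpa only [ha] using hg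

variable (hπ : Function.Surjective π)

include hπ

theorem exists_indep_of_le_finrank {n : ℕ} (h : n ≤ Module.finrank (ZMod p) E) :
    ∃ x : Fin n → A, ∀ a : Fin n → ℤ, π (∑ i, a i • x i) = 0 → ∀ i, (p : ℤ) ∣ a i := by
  obtain ⟨f, hf⟩ := exists_linearIndependent_of_le_finrank h
  choose x hx using fun i => hπ (f i)
  exact ⟨x, (linearIndependent_comp_iff p π x).mp (by simpa only [hx] using hf)⟩

end Dimension

/-! ### Splitting off hyperbolic planes -/

section Hyperbolic

variable (p : ℕ) [Fact p.Prime] {L : QLattice V}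

theorem IsSplitByHyperbolicAt.localValues_eq (hL : L.IsNormalized)
    (h : L.IsSplitByHyperbolicAt p) :
    L.localValues p = {a : ℚ_[p] | ∃ z : ℤ_[p], a = 2 * (z : ℚ_[p])} := by
  obtain ⟨e, f, M, hee, hff, hef, -, -, hs⟩ := h
  have he : e ∈ L.localLat p :=
    hs.le (Submodule.mem_sup_left (Submodule.subset_span (by simp)))
  have hf : f ∈ L.localLat p :=
    hs.le (Submodule.mem_sup_left (Submodule.subset_span (by simp)))
  ext a
  constructor
  · rintro ⟨x, hx, rfl⟩
    exact hL.localForm_even p hx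
  · rintro ⟨z, rfl⟩
    refine ⟨e + z • f, Submodule.add_mem _ he (Submodule.smul_mem _ _ hf), ?_⟩
    simp only [map_add, LinearMap.add_apply, localForm_smul_left, localForm_smul_right, hee, hff,
      hef, localForm_symm p L f e]
    ring

/-- A unimodular plane inside an integral lattice splits off: the projection `B(f,x) e + B(e,x) f`
has integral coefficients. -/
theorem isSplitByHyperbolicAt_of_pair (hL : L.IsNormalized) {e f : ℚ_[p] ⊗[ℚ] V}
    (he : e ∈ L.localLat p) (hf : f ∈ L.localLat p) (hee : L.localForm p e e = 0)
    (hff : L.localForm p f f = 0) (hef : L.localForm p e f = 1) :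
    L.IsSplitByHyperbolicAt p := by
  have hfe : L.localForm p f e = 1 := by rw [localForm_symm, hef]
  let M : Submodule ℤ_[p] (ℚ_[p] ⊗[ℚ] V) := L.localLat p ⊓
    ((LinearMap.ker (L.localForm p e) ⊓ LinearMap.ker (L.localForm p f)).restrictScalars ℤ_[p])
  have hM : ∀ x, x ∈ M ↔ x ∈ L.localLat p ∧ L.localForm p e x = 0 ∧ L.localForm p f x = 0 :=
    fun x => Iff.rfl
  refine ⟨e, f, M, hee, hff, hef, fun x hx => ((hM x).mp hx).2, ?_, le_antisymm (sup_le ?_ ?_) ?_⟩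
  · rw [Submodule.disjoint_def]
    intro x hx hxM
    obtain ⟨a, b, rfl⟩ := Submodule.mem_span_pair.mp hx
    obtain ⟨-, h1, h2⟩ := (hM _).mp hxM
    simp only [map_add, localForm_smul_right, hee, hef, hfe, hff, mul_zero, mul_one, zero_add,
      add_zero] at h1 h2
    rw [PadicInt.coe_eq_zero] at h1 h2
    simp [h1, h2]
  · rw [Submodule.span_le]
    rintro _ (rfl | rfl)
    · exact he
    · exact hf
  · exact fun x hx => ((hM x).mp hx).1
  · intro x hx
    obtain ⟨a, ha⟩ := localForm_integral p hL.1 he hx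
    obtain ⟨b, hb⟩ := localForm_integral p hL.1 hf hx
    have hmem : b • e + a • f ∈ Submodule.span ℤ_[p] {e, f} :=
      Submodule.mem_span_pair.mpr ⟨b, a, rfl⟩
    rw [← add_sub_cancel (b • e + a • f) x]
    refine Submodule.add_mem_sup hmem ((hM _).mpr ⟨?_, ?_, ?_⟩)
    · exact Submodule.sub_mem _ hx (Submodule.add_mem _ (Submodule.smul_mem _ _ he)
        (Submodule.smul_mem _ _ hf))
    · simp only [map_sub, map_add, localForm_smul_right, hee, hef, ha]
      ring
    · simp only [map_sub, map_add, localForm_smul_right, hfe, hff, hb]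
      ring

/-- With `Q y = 2s`, half of `Q (x + t y)` is `s t² + l t + p k`, which has a root `t ∈ pℤ_p`
because `l` is a unit. The isotropic vector `x + t y` still pairs with `y` to a unit. -/
theorem isSplitByHyperbolicAt_of_dvd (hL : L.IsNormalized) {x y : V} (hx : x ∈ L.lat)
    (hy : y ∈ L.lat) {k l : ℤ} (hk : L.Q x = 2 * p * k) (hl : L.form x y = l)
    (hpl : ¬ (p : ℤ) ∣ l) : L.IsSplitByHyperbolicAt p := by
  obtain ⟨s, hs⟩ := hL.even hy
  have hlu : IsUnit (l : ℤ_[p]) := by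
    rw [PadicInt.isUnit_iff]
    refine le_antisymm (PadicInt.norm_le_one _) (not_lt.mp fun h => hpl ?_)
    rwa [PadicInt.norm_int_lt_one_iff_dvd] at h
  have hpk : ‖(p * k : ℤ_[p])‖ < 1 := by
    have := (PadicInt.norm_int_lt_one_iff_dvd (p := p) (p * k)).mpr (dvd_mul_right _ _)
    simpa using this
  obtain ⟨t, ht1, ht⟩ := exists_root_quadratic p (a := s) hlu hpk
  have hu : IsUnit (l + 2 * t * s : ℤ_[p]) := by
    have h2 : ‖2 * t * (s : ℤ_[p])‖ < 1 := by
      rw [mul_comm (2 : ℤ_[p]), mul_assoc, norm_mul]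
      exact mul_lt_one_of_nonneg_of_lt_one_left (norm_nonneg _) ht1 (PadicInt.norm_le_one _)
    have h3 := PadicInt.isUnit_iff.mp hlu
    rw [PadicInt.isUnit_iff, PadicInt.norm_add_eq_max_of_ne (by rw [h3]; exact h2.ne'), h3]
    exact max_eq_left h2.le
  obtain ⟨v, hv⟩ := hu.exists_right_inv
  set X := (1 : ℚ_[p]) ⊗ₜ[ℚ] x with hX
  set Y := (1 : ℚ_[p]) ⊗ₜ[ℚ] y with hY
  have hXm : X ∈ L.localLat p := tmul_mem_localLat p hx
  have hYm : Y ∈ L.localLat p := tmul_mem_localLat p hy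
  have hXX : L.localForm p X X = 2 * p * k := by
    rw [hX, localForm_tmul, ← Q, hk]
    push_cast
    rfl
  have hYY : L.localForm p Y Y = 2 * s := by
    rw [hY, localForm_tmul, ← Q, hs]
    push_cast
    rfl
  have hXY : L.localForm p X Y = l := by
    rw [hX, hY, localForm_tmul, hl]
    push_cast
    rfl
  have hYX : L.localForm p Y X = l := by rw [localForm_symm, hXY]
  have ht' := congrArg (fun z : ℤ_[p] => (z : ℚ_[p])) ht
  have hv' := congrArg (fun z : ℤ_[p] => (z : ℚ_[p])) hv
  have h2c : ((2 : ℤ_[p]) : ℚ_[p]) = 2 := rfl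
  push_cast [h2c] at ht' hv'
  have hE : X + t • Y ∈ L.localLat p := Submodule.add_mem _ hXm (Submodule.smul_mem _ _ hYm)
  have hEE : L.localForm p (X + t • Y) (X + t • Y) = 0 := by
    simp only [map_add, LinearMap.add_apply, localForm_smul_left, localForm_smul_right, hXX, hYY,
      hXY, hYX]
    linear_combination 2 * ht'
  have hEY : L.localForm p (X + t • Y) Y = l + 2 * t * s := by
    simp only [map_add, LinearMap.add_apply, localForm_smul_left, hYY, hXY]
    ring
  have hYE : L.localForm p Y (X + t • Y) = l + 2 * t * s := by rw [localForm_symm, hEY]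
  generalize X + t • Y = e at hE hEE hEY hYE
  -- Scaling `Y` by `v` makes the pairing with `e` equal to 1; subtracting `s v² e` then removes `Q
  -- (v Y) = 2 s v²`.
  refine isSplitByHyperbolicAt_of_pair p hL hE (f := v • Y - (s * v ^ 2) • e)
    (Submodule.sub_mem _ (Submodule.smul_mem _ _ hYm) (Submodule.smul_mem _ _ hE)) hEE ?_ ?_
  · simp only [map_sub, LinearMap.sub_apply, localForm_smul_left, localForm_smul_right, hEE, hYY,
      hEY, hYE]
    push_cast
    linear_combination (-2 * s * v ^ 2 : ℚ_[p]) * hv'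
  · simp only [map_sub, localForm_smul_right, hEE, hEY]
    linear_combination hv'

end Hyperbolic

/-! ### Watson transformations of normalized lattices -/

section Watson

variable (p : ℕ) {L : QLattice V}

theorem Q_add (L : QLattice V) (x y : V) : L.Q (x + y) = L.Q x + L.Q y + 2 * L.form x y := by
  simp only [Q, map_add, LinearMap.add_apply, L.symm y x]
  ring

theorem Q_zsmul (L : QLattice V) (a : ℤ) (x : V) : L.Q (a • x) = a ^ 2 * L.Q x := by
  simp only [Q, map_zsmul, LinearMap.smul_apply, zsmul_eq_mul]
  ring

theorem isNormalized_of_even (heven : ∀ x ∈ L.lat, ∃ k : ℤ, L.Q x = 2 * k)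
    (h2 : 2 ∈ L.normIdeal) : L.IsNormalized := by
  refine ⟨(isIntegral_iff L).mpr fun x hx y hy => ?_, le_antisymm ?_ ?_⟩
  · obtain ⟨k, hk⟩ := heven x hx
    obtain ⟨l, hl⟩ := heven y hy
    obtain ⟨m, hm⟩ := heven (x + y) (L.lat.add_mem hx hy)
    refine ⟨m - k - l, ?_⟩
    rw [Q_add, hk, hl] at hm
    push_cast
    linear_combination hm / 2
  · refine Submodule.span_le.mpr ?_
    rintro _ ⟨x, hx, rfl⟩
    obtain ⟨k, hk⟩ := heven x hx
    exact Submodule.mem_span_singleton.mpr ⟨k, by rw [hk]; simp [mul_comm]⟩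
  · rw [Submodule.span_singleton_le_iff_mem]
    exact h2

/-- Every `x ∈ L` with `Q x ∈ 2pℤ` pairs `L` into `pℤ`; equivalently, `Λ_{2p}(L)` consists of all
such `x`. -/
def IsWatsonAnisotropic (L : QLattice V) : Prop :=
  ∀ x ∈ L.lat, (∃ k : ℤ, L.Q x = 2 * p * k) → ∀ y ∈ L.lat, ∃ l : ℤ, L.form x y = p * l

theorem mem_watsonLat_two_mul_iff (x : V) :
    x ∈ L.watsonLat (2 * p) ↔ x ∈ L.lat ∧ (∃ k : ℤ, L.Q x = 2 * p * k) ∧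
      ∀ y ∈ L.lat, ∃ l : ℤ, L.form x y = p * l := by
  rw [mem_watsonLat]
  refine and_congr_right fun hx => ⟨fun h => ?_, ?_⟩
  · obtain ⟨k, hk⟩ := h 0 L.lat.zero_mem
    have hk' : L.Q x = 2 * p * k := by
      simpa [Q] using hk
    refine ⟨⟨k, hk'⟩, fun y hy => ?_⟩
    obtain ⟨l, hl⟩ := h y hy
    refine ⟨l - k, ?_⟩
    rw [Q_add] at hl
    push_cast at hl ⊢
    linear_combination (hl - hk') / 2
  · rintro ⟨⟨k, hk⟩, h⟩ z hz
    obtain ⟨l, hl⟩ := h z hz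
    refine ⟨k + l, ?_⟩
    rw [Q_add, hk, hl]
    push_cast
    ring

theorem IsWatsonAnisotropic.mem_watsonLat_iff (h : L.IsWatsonAnisotropic p) (x : V) :
    x ∈ L.watsonLat (2 * p) ↔ x ∈ L.lat ∧ ∃ k : ℤ, L.Q x = 2 * p * k := by
  rw [mem_watsonLat_two_mul_iff p]
  exact ⟨fun ⟨h1, h2, _⟩ => ⟨h1, h2⟩, fun ⟨h1, h2⟩ => ⟨h1, h2, h x h1 h2⟩⟩

/-- An admissible sequence `r` whose effect on `L` is to single out the `x` with
`Q x ∈ 2p^m ℤ` and to divide the form by `p^m`, and which preserves strict regularity. -/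
structure IsWatsonChain (hm : 0 < 2 * p) (n : ℕ) (L : QLattice V) (r : List {r : ℚ // 0 < r})
    (m : ℕ) : Prop where
  admissible : L.Admissible (2 * p) hm r
  normalized : (L.watsonSeq (2 * p) hm r).IsNormalized
  regular : (L.watsonSeq (2 * p) hm r).IsStrictlyRegular n
  form_eq : (L.watsonSeq (2 * p) hm r).form = ((p : ℚ) ^ m)⁻¹ • L.form
  mem_iff : ∀ x, x ∈ (L.watsonSeq (2 * p) hm r).lat ↔
    x ∈ L.lat ∧ ∃ k : ℤ, L.Q x = 2 * p ^ m * k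

theorem zsmul_mem_watsonLat (hL : L.IsNormalized) {x : V} (hx : x ∈ L.lat) :
    (p : ℤ) • x ∈ L.watsonLat (2 * p) := by
  rw [mem_watsonLat_two_mul_iff p]
  refine ⟨L.lat.smul_mem _ hx, ?_, fun y hy => ?_⟩
  · obtain ⟨k, hk⟩ := hL.even hx
    refine ⟨p * k, ?_⟩
    rw [Q_zsmul, hk]
    push_cast
    ring
  · obtain ⟨k, hk⟩ := (isIntegral_iff L).mp hL.1 x hx y hy
    refine ⟨k, ?_⟩
    rw [map_zsmul, LinearMap.smul_apply, hk, zsmul_eq_mul]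
    push_cast
    rfl

section Chain

variable {p} {hm : 0 < 2 * p} {n : ℕ}

theorem IsWatsonChain.nil (hL : L.IsNormalized) (hreg : L.IsStrictlyRegular n) :
    IsWatsonChain p hm n L [] 0 where
  admissible := fun i hi => absurd hi (by simp)
  normalized := hL
  regular := hreg
  form_eq := by simp [watsonSeq]
  mem_iff x := by
    refine ⟨fun hx => ⟨hx, ?_⟩, fun h => h.1⟩
    simpa using hL.even (L := L) hx

theorem IsWatsonChain.Q_eq {r : List {r : ℚ // 0 < r}} {m : ℕ}
    (h : IsWatsonChain p hm n L r m) (x : V) :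
    (L.watsonSeq (2 * p) hm r).Q x = ((p : ℚ) ^ m)⁻¹ * L.Q x := by
  rw [Q, h.form_eq]
  rfl

end Chain

variable [Fact p.Prime]

theorem IsNormalized.exists_Q_eq_iff (hL : L.IsNormalized) {x : V} (hx : x ∈ L.lat) :
    (∃ z : ℤ_[p], (L.Q x : ℚ_[p]) = 2 * p * z) ↔ ∃ k : ℤ, L.Q x = 2 * p * k := by
  constructor
  · rintro ⟨z, hz⟩
    obtain ⟨k, hk⟩ := hL.even hx
    rw [hk] at hz
    push_cast at hz
    obtain ⟨l, hl⟩ := intCast_eq_mul_of_padic p (k := k) (m := 1) (z := z) (by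
      refine mul_left_cancel₀ (two_ne_zero (α := ℚ_[p])) ?_
      linear_combination hz)
    refine ⟨l, ?_⟩
    rw [hk, hl]
    push_cast
    ring
  · rintro ⟨k, hk⟩
    refine ⟨k, ?_⟩
    rw [hk]
    push_cast
    rfl

theorem prime_pow_inv_pos (j : ℕ) : 0 < ((p : ℚ) ^ j)⁻¹ :=
  inv_pos.mpr (pow_pos (by exact_mod_cast (Fact.out : p.Prime).pos) _)

/-- Since `pL ⊆ Λ_{2p}(L)`, the norm of `Λ_{2p}(L)` lies between `2p²ℤ` and `2pℤ`, so it is one of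
the two; `j` is 2 or 1 accordingly. -/
theorem exists_isNormalized_watson (hm : 0 < 2 * p) (hL : L.IsNormalized) :
    ∃ j : ℕ, 1 ≤ j ∧ (L.watson (2 * p) hm ⟨((p : ℚ) ^ j)⁻¹, prime_pow_inv_pos p j⟩).IsNormalized ∧
      ∀ x ∈ L.watsonLat (2 * p), ∃ k : ℤ, L.Q x = 2 * p ^ j * k := by
  have hp0 : (p : ℚ) ≠ 0 := by exact_mod_cast (Fact.out : p.Prime).ne_zero
  have hQ : ∀ r x, (L.watson (2 * p) hm r).Q x = r.1 * L.Q x := fun r x => rfl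
  have hideal : ∀ r : {r : ℚ // 0 < r}, ∀ a ∈ L.normIdeal,
      r.1 * p ^ 2 * a ∈ (L.watson (2 * p) hm r).normIdeal := by
    intro r a ha
    rw [normIdeal] at ha
    induction ha using Submodule.span_induction with
    | mem a ha =>
      obtain ⟨x, hx, rfl⟩ := ha
      refine Submodule.subset_span ⟨(p : ℤ) • x, zsmul_mem_watsonLat p hL hx, ?_⟩
      rw [hQ, Q_zsmul]
      push_cast
      ring
    | zero => simp
    | add a b _ _ h1 h2 =>
      rw [mul_add]
      exact Submodule.add_mem _ h1 h2
    | smul n a _ h1 =>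
      rw [mul_smul_comm]
      exact Submodule.smul_mem _ _ h1
  have h2 : (2 : ℚ) ∈ L.normIdeal := by
    rw [hL.2]
    exact Submodule.mem_span_singleton_self _
  have hmem := mem_watsonLat_two_mul_iff p (L := L)
  by_cases hall : ∀ x ∈ L.watsonLat (2 * p), ∃ k : ℤ, L.Q x = 2 * p ^ 2 * k
  · refine ⟨2, by norm_num, isNormalized_of_even (fun x hx => ?_) ?_, hall⟩
    · obtain ⟨k, hk⟩ := hall x hx
      refine ⟨k, ?_⟩
      rw [hQ, hk]
      field_simp
    · have := hideal ⟨((p : ℚ) ^ 2)⁻¹, prime_pow_inv_pos p 2⟩ 2 h2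
      rwa [inv_mul_cancel₀ (pow_ne_zero 2 hp0), one_mul] at this
  · have hone : ∀ x ∈ L.watsonLat (2 * p), ∃ k : ℤ, L.Q x = 2 * p ^ 1 * k := fun x hx => by
      simpa using ((hmem x).mp hx).2.1
    refine ⟨1, le_rfl, isNormalized_of_even (fun x hx => ?_) ?_, hone⟩
    · obtain ⟨k, hk⟩ := hone x hx
      refine ⟨k, ?_⟩
      rw [hQ, hk]
      field_simp
    · push Not at hall
      obtain ⟨x, hx, hxk⟩ := hall
      obtain ⟨k, hk⟩ := hone x hx
      have hcop : IsCoprime (p : ℤ) k := by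
        rw [Prime.coprime_iff_not_dvd (Nat.prime_iff_prime_int.mp Fact.out)]
        rintro ⟨l, rfl⟩
        refine hxk l ?_
        rw [hk]
        push_cast
        ring
      obtain ⟨a, b, hab⟩ := hcop
      have h3 := hideal ⟨((p : ℚ) ^ 1)⁻¹, prime_pow_inv_pos p 1⟩ 2 h2
      have h4 : (2 * k : ℚ) ∈
          (L.watson (2 * p) hm ⟨((p : ℚ) ^ 1)⁻¹, prime_pow_inv_pos p 1⟩).normIdeal := by
        refine Submodule.subset_span ⟨x, hx, ?_⟩
        rw [hQ, hk]
        field_simp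
      have h5 := Submodule.add_mem _ (Submodule.smul_mem _ a h3) (Submodule.smul_mem _ b h4)
      convert h5 using 1
      have hab' : (a * p + b * k : ℚ) = 1 := by exact_mod_cast hab
      simp only [zsmul_eq_mul]
      field_simp
      linear_combination -hab'

theorem watsonSeq_append (m : ℕ) (hm : 0 < m) (r : List {r : ℚ // 0 < r})
    (s : {r : ℚ // 0 < r}) (L : QLattice V) :
    L.watsonSeq m hm (r ++ [s]) = (L.watsonSeq m hm r).watson m hm s := by
  induction r generalizing L with
  | nil => rfl
  | cons a r ih => exact ih _

theorem Admissible.append {m : ℕ} {hm : 0 < m} {r : List {r : ℚ // 0 < r}}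
    {s : {r : ℚ // 0 < r}} (h : L.Admissible m hm r)
    (hs : ((L.watsonSeq m hm r).watson m hm s).IsNormalized) :
    L.Admissible m hm (r ++ [s]) := by
  intro i hi
  rw [List.length_append, List.length_singleton] at hi
  rcases Nat.lt_succ_iff_lt_or_eq.mp hi with hi | rfl
  · rw [List.take_append_of_le_length hi]
    exact h i hi
  · rw [List.take_of_length_le (by simp), watsonSeq_append]
    exact hs

variable {p} {hm : 0 < 2 * p} {n : ℕ}

/-- At an anisotropic stage one more transformation only imposes a condition on `Q`, so
`IsStrictlyRegular.sublattice` applies; `j ≥ 1` makes the exponent grow. -/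
theorem IsWatsonChain.exists_append {r : List {r : ℚ // 0 < r}} {m : ℕ}
    (h : IsWatsonChain p hm n L r m)
    (hs : (L.watsonSeq (2 * p) hm r).IsWatsonAnisotropic p) :
    ∃ s j, 1 ≤ j ∧ IsWatsonChain p hm n L (r ++ [s]) (m + j) := by
  have hp0 : (p : ℚ) ≠ 0 := by exact_mod_cast (Fact.out : p.Prime).ne_zero
  obtain ⟨j, hj, hnorm, hall⟩ := exists_isNormalized_watson p hm h.normalized
  have hmem := hs.mem_watsonLat_iff p
  refine ⟨⟨((p : ℚ) ^ j)⁻¹, prime_pow_inv_pos p j⟩, j, hj, h.admissible.append hnorm, ?_, ?_, ?_, ?_⟩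
  all_goals rw [watsonSeq_append]
  · exact hnorm
  · refine h.regular.sublattice p (prime_pow_inv_pos p j) h.normalized rfl (fun x => ?_)
      (fun x hx => zsmul_mem_watsonLat p h.normalized hx)
    refine (hmem x).trans (and_congr_right fun hx => ?_)
    exact (h.normalized.exists_Q_eq_iff p hx).symm
  · change ((p : ℚ) ^ j)⁻¹ • (L.watsonSeq (2 * p) hm r).form = _
    rw [h.form_eq, smul_smul, pow_add, mul_inv, mul_comm]
  · intro x
    constructor
    · intro hx
      obtain ⟨k, hk⟩ := hall x hx
      refine ⟨((h.mem_iff x).mp (watsonLat_le _ _ hx)).1, k, ?_⟩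
      rw [h.Q_eq] at hk
      field_simp at hk
      rw [hk, pow_add]
      ring
    · rintro ⟨hx, k, hk⟩
      refine (hmem x).mpr ⟨(h.mem_iff x).mpr ⟨hx, p ^ j * k, ?_⟩, p ^ (j - 1) * k, ?_⟩
      · rw [hk, pow_add]
        push_cast
        ring
      · have : (p : ℚ) ^ (m + j) = p ^ m * (p * p ^ (j - 1)) := by
          rw [← pow_succ', Nat.sub_add_cancel hj, pow_add]
        rw [h.Q_eq, hk, this]
        push_cast
        field_simp

theorem exists_isWatsonChain_ge (hL : L.IsNormalized) (hreg : L.IsStrictlyRegular n)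
    (h : ∀ r m, IsWatsonChain p hm n L r m →
      (L.watsonSeq (2 * p) hm r).IsWatsonAnisotropic p) (N : ℕ) :
    ∃ r m, N ≤ m ∧ IsWatsonChain p hm n L r m := by
  induction N with
  | zero => exact ⟨[], 0, le_rfl, .nil hL hreg⟩
  | succ N ih =>
    obtain ⟨r, m, hNm, hr⟩ := ih
    obtain ⟨s, j, hj, hs⟩ := hr.exists_append (h r m hr)
    exact ⟨_, _, by omega, hs⟩

/-- The new lattice lies between `p^m L` and `L`, so away from `p` only the form changes, by the
factor `p^(-m)`. -/
theorem IsWatsonChain.locallyIsometricScaled {r : List {r : ℚ // 0 < r}} {m : ℕ}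
    (h : IsWatsonChain p hm n L r m) (hL : L.IsNormalized) {q : ℕ} [Fact q.Prime] (hq : q ≠ p) :
    ∃ c : ℚ, 0 < c ∧ L.LocallyIsometricScaled q (c : ℚ_[q]) (L.watsonSeq (2 * p) hm r) := by
  refine ⟨_, prime_pow_inv_pos p m, LinearEquiv.refl _ _, fun x y => ?_, ?_⟩
  · exact localForm_of_form_eq q h.form_eq x y
  · have hloc := localLat_eq_of_ne p hq (L := L) (M := L.watsonSeq (2 * p) hm r) (m := m)
      (fun x hx => ((h.mem_iff x).mp hx).1) fun x hx => by
        obtain ⟨k, hk⟩ := hL.even hx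
        refine (h.mem_iff _).mpr ⟨L.lat.smul_mem _ hx, p ^ m * k, ?_⟩
        rw [Q_zsmul, hk]
        push_cast
        ring
    rw [hloc]
    exact Set.image_id _

theorem isSplitByHyperbolicAt_of_not_isWatsonAnisotropic (hL : L.IsNormalized)
    (h : ¬ L.IsWatsonAnisotropic p) : L.IsSplitByHyperbolicAt p := by
  rw [IsWatsonAnisotropic] at h
  push Not at h
  obtain ⟨x, hx, ⟨k, hk⟩, y, hy, hl⟩ := h
  obtain ⟨l, hl'⟩ := (isIntegral_iff L).mp hL.1 x hx y hy
  refine isSplitByHyperbolicAt_of_dvd p hL hx hy hk hl' ?_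
  rintro ⟨t, rfl⟩
  exact hl t (by rw [hl']; push_cast; rfl)

end Watson

/-! ### Anisotropic lattices -/

section Anisotropic

variable (p : ℕ) [Fact p.Prime]

theorem exists_eq_zsmul_iff {L : QLattice V} {ι : Type*} {b : Module.Basis ι ℚ V}
    (hb : L.lat = Submodule.span ℤ (Set.range b)) (x : V) :
    (∃ y ∈ L.lat, x = (p : ℤ) • y) ↔ ∀ i, ∃ k : ℤ, b.repr x i = p * k := by
  have hp0 : (p : ℚ) ≠ 0 := by exact_mod_cast (Fact.out : p.Prime).ne_zero
  constructor
  · rintro ⟨y, hy, rfl⟩ i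
    obtain ⟨k, hk⟩ := (mem_lat_iff hb y).mp hy i
    exact ⟨k, by simp [hk]⟩
  · intro h
    refine ⟨(p : ℚ)⁻¹ • x, (mem_lat_iff hb _).mpr fun i => ?_, ?_⟩
    · obtain ⟨k, hk⟩ := h i
      refine ⟨k, ?_⟩
      rw [map_smul, Finsupp.smul_apply, hk, smul_eq_mul]
      field_simp
    · rw [← Int.cast_smul_eq_zsmul ℚ, smul_smul, Int.cast_natCast, mul_inv_cancel₀ hp0, one_smul]

theorem exists_form_eq (L : QLattice V) (f : V →ₗ[ℚ] ℚ) : ∃ y, ∀ x, L.form x y = f x := by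
  obtain ⟨b, -⟩ := L.exists_basis
  have : Module.Finite ℚ V := Module.Finite.of_basis b
  have hinj : Function.Injective (L.form : V →ₗ[ℚ] Module.Dual ℚ V) := by
    rw [injective_iff_map_eq_zero]
    intro x hx
    by_contra hne
    have := L.pos x hne
    rw [hx] at this
    simp at this
  have hsurj := (LinearMap.injective_iff_surjective_of_finrank_eq_finrank
    (Subspace.dual_finrank_eq (K := ℚ) (V := V)).symm).mp hinj
  obtain ⟨y, hy⟩ := hsurj f
  exact ⟨y, fun x => by rw [L.symm, hy]⟩

/-- A lattice vector that pairs `L` into a high power of `p` is divisible by `p`. -/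
theorem exists_pow_form_dvd (L : QLattice V) : ∃ a : ℕ, ∀ x ∈ L.lat,
    (∀ y ∈ L.lat, ∃ l : ℤ, L.form x y = p ^ a * l) → ∃ y ∈ L.lat, x = (p : ℤ) • y := by
  obtain ⟨b, hb⟩ := L.exists_basis
  choose y hy using fun i => L.exists_form_eq (b.coord i)
  choose d hd0 hd using fun i => L.exists_zsmul_mem (y i)
  -- The `y i` form the dual basis and `d i` clears its denominators. The exponent is crude: `p^a >
  -- a ≥ |d i|` prevents `p^a` from dividing `d i`.
  refine ⟨∑ i, (d i).natAbs, fun x hx h => (exists_eq_zsmul_iff p hb x).mpr fun i => ?_⟩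
  obtain ⟨k, hk⟩ := (mem_lat_iff hb x).mp hx i
  obtain ⟨l, hl⟩ := h _ (hd i)
  rw [map_zsmul, hy, Module.Basis.coord_apply, hk, zsmul_eq_mul] at hl
  have hl' : d i * k = p ^ (∑ i, (d i).natAbs) * l := by exact_mod_cast hl
  suffices (p : ℤ) ∣ k by
    obtain ⟨t, rfl⟩ := this
    exact ⟨t, by rw [hk]; push_cast; rfl⟩
  by_contra hpk
  have hcop : IsCoprime ((p : ℤ) ^ (∑ i, (d i).natAbs)) k :=
    ((Nat.prime_iff_prime_int.mp Fact.out).coprime_iff_not_dvd.mpr hpk).pow_left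
  have hdvd : (p : ℤ) ^ (∑ i, (d i).natAbs) ∣ d i := hcop.dvd_of_dvd_mul_right ⟨l, hl'⟩
  have h1 := Nat.le_of_dvd (Int.natAbs_pos.mpr (hd0 i)) (Int.natAbs_dvd_natAbs.mpr hdvd)
  rw [Int.natAbs_pow, Int.natAbs_natCast] at h1
  have h2 : (d i).natAbs ≤ ∑ i, (d i).natAbs :=
    Finset.single_le_sum (f := fun i => (d i).natAbs) (fun _ _ => Nat.zero_le _)
      (Finset.mem_univ i)
  exact absurd ((Nat.lt_pow_self (Fact.out : p.Prime).one_lt).trans_le h1) (by omega)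

/-- If the `x ∈ L` with `Q x ∈ 2p^m ℤ` form a group for some large `m`, then they are all divisible
by `p`. -/
theorem exists_bound_dvd {L : QLattice V} (hL : L.IsNormalized) :
    ∃ m₀ : ℕ, ∀ m ≥ m₀, ∀ M : Submodule ℤ V,
      (∀ x, x ∈ M ↔ x ∈ L.lat ∧ ∃ k : ℤ, L.Q x = 2 * p ^ m * k) →
      ∀ x ∈ M, ∃ y ∈ L.lat, x = (p : ℤ) • y := by
  have hp0 : (p : ℚ) ≠ 0 := by exact_mod_cast (Fact.out : p.Prime).ne_zero
  obtain ⟨a, ha⟩ := L.exists_pow_form_dvd p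
  refine ⟨2 * a + 1, fun m hm M hM x hx => ha x ((hM x).mp hx).1 fun y hy => ?_⟩
  -- Here `s = ⌈m/2⌉`, so `p^s y ∈ M`. Closure of `M` under addition then makes `B(x, p^s y)`
  -- divisible by `p^m`, and `m - s ≥ a`.
  obtain ⟨s, t, e, hst, hse⟩ : ∃ s t e : ℕ, m = s + (a + t) ∧ 2 * s = m + e :=
    ⟨(m + 1) / 2, m - (m + 1) / 2 - a, 2 * ((m + 1) / 2) - m, by omega, by omega⟩
  obtain ⟨k, hk⟩ := ((hM x).mp hx).2
  obtain ⟨l, hl⟩ := hL.even hy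
  have hsy : L.Q ((p ^ s : ℤ) • y) = 2 * p ^ m * (p ^ e * l) := by
    rw [Q_zsmul, hl]
    push_cast
    rw [← pow_mul, mul_comm s, hse, pow_add]
    ring
  have hyM : (p ^ s : ℤ) • y ∈ M :=
    (hM _).mpr ⟨L.lat.smul_mem _ hy, p ^ e * l, by rw [hsy]; push_cast; rfl⟩
  obtain ⟨j, hj⟩ := ((hM _).mp (M.add_mem hx hyM)).2
  refine ⟨p ^ t * (j - k - p ^ e * l), ?_⟩
  rw [Q_add, hk, hsy, map_zsmul, zsmul_eq_mul] at hj
  have h1 : (p : ℚ) ^ s * L.form x y = p ^ s * (p ^ a * (p ^ t * (j - k - p ^ e * l))) := by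
    have : (p : ℚ) ^ m = p ^ s * (p ^ a * p ^ t) := by rw [hst, pow_add, pow_add]
    push_cast at hj
    rw [this] at hj
    linear_combination hj / 2
  push_cast
  exact mul_left_cancel₀ (pow_ne_zero s hp0) h1

/-- Infinite descent: an isotropic vector is congruent modulo `p^m` to some `v ∈ L` with `Q v ∈ 2p^m
ℤ`, so it is divisible by `p`, and the quotient is again isotropic. -/
theorem not_isIsotropicAt {L : QLattice V} (hL : L.IsNormalized) {m : ℕ} (hm : m ≠ 0)
    (h : ∀ x ∈ L.lat, (∃ k : ℤ, L.Q x = 2 * p ^ m * k) → ∃ y ∈ L.lat, x = (p : ℤ) • y) :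
    ¬ L.IsIsotropicAt p := by
  have hpK : (p : ℚ_[p]) ≠ 0 := by exact_mod_cast (Fact.out : p.Prime).ne_zero
  have step : ∀ x ∈ L.localLat p, L.localForm p x x = 0 →
      ∃ y ∈ L.localLat p, x = (p : ℤ_[p]) • y := by
    intro x hx hx0
    obtain ⟨v, hv, w, hw, hxv⟩ := exists_approx p hx m
    obtain ⟨k, hk⟩ := hL.even hv
    obtain ⟨s, hs⟩ := localForm_integral p hL.1 (tmul_mem_localLat p hv) hw
    obtain ⟨t, ht⟩ := hL.localForm_even p hw
    have hvv : L.localForm p ((1 : ℚ_[p]) ⊗ₜ[ℚ] v) ((1 : ℚ_[p]) ⊗ₜ[ℚ] v) = 2 * k := by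
      rw [localForm_tmul, ← Q, hk]
      push_cast
      rfl
    obtain ⟨l, hl⟩ := intCast_eq_mul_of_padic p (k := k) (m := m) (z := -s - p ^ m * t) (by
      rw [hxv] at hx0
      simp only [map_add, LinearMap.add_apply, localForm_smul_left, localForm_smul_right, hvv, hs,
        ht, localForm_symm p L w] at hx0
      push_cast at hx0 ⊢
      linear_combination hx0 / 2)
    obtain ⟨y, hy, rfl⟩ := h v hv ⟨l, by rw [hk, hl]; push_cast; ring⟩
    refine ⟨(1 : ℚ_[p]) ⊗ₜ[ℚ] y + (p ^ (m - 1) : ℤ_[p]) • w,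
      Submodule.add_mem _ (tmul_mem_localLat p hy) (Submodule.smul_mem _ _ hw), ?_⟩
    rw [hxv, smul_add, smul_smul, ← pow_succ', Nat.sub_add_cancel (Nat.one_le_iff_ne_zero.mpr hm),
      TensorProduct.tmul_smul, ← Int.cast_smul_eq_zsmul ℤ_[p]]
    push_cast
    rfl
  have steps : ∀ N : ℕ, ∀ x ∈ L.localLat p, L.localForm p x x = 0 →
      ∃ y ∈ L.localLat p, x = (p ^ N : ℤ_[p]) • y := by
    intro N
    induction N with
    | zero => exact fun x hx _ => ⟨x, hx, by simp⟩
    | succ N ih =>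
      intro x hx hx0
      obtain ⟨y, hy, rfl⟩ := step x hx hx0
      rw [localForm_smul_left, localForm_smul_right, PadicInt.coe_natCast] at hx0
      obtain ⟨z, hz, rfl⟩ := ih y hy
        ((mul_eq_zero.mp ((mul_eq_zero.mp hx0).resolve_left hpK)).resolve_left hpK)
      exact ⟨z, hz, by rw [smul_smul, pow_succ']⟩
  rintro ⟨x, hx, hne, hx0⟩
  obtain ⟨b, hb⟩ := L.exists_basis
  apply hne
  apply (Algebra.TensorProduct.basis ℚ_[p] b).repr.injective
  rw [map_zero]
  ext i
  obtain ⟨z, hz⟩ := (mem_localLat_iff p hb x).mp hx i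
  rw [hz, Finsupp.zero_apply, PadicInt.coe_eq_zero]
  by_contra hz0
  obtain ⟨N, hN⟩ := FiniteMultiplicity.of_not_isUnit (a := (p : ℤ_[p])) (b := z)
    PadicInt.prime_p.not_isUnit hz0
  apply hN
  obtain ⟨y, hy, hxy⟩ := steps (N + 1) x hx hx0
  obtain ⟨z', hz'⟩ := (mem_localLat_iff p hb y).mp hy i
  refine ⟨z', PadicInt.ext ?_⟩
  rw [← hz, hxy, ← algebraMap_smul ℚ_[p] _ y, map_smul, Finsupp.smul_apply, hz', smul_eq_mul]
  rfl

theorem exists_mod_map (L : QLattice V) :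
    ∃ π : L.lat →+ (Fin (Module.finrank ℚ V) → ZMod p), Function.Surjective π ∧
      ∀ x, π x = 0 ↔ ∃ y ∈ L.lat, (x : V) = (p : ℤ) • y := by
  obtain ⟨b, hb⟩ := L.exists_basis
  let c : Module.Basis (Fin (Module.finrank ℚ V)) ℤ L.lat :=
    (b.restrictScalars ℤ).map (LinearEquiv.ofEq _ _ hb.symm)
  have hrepr : ∀ (x : L.lat) i, b.repr x i = c.repr x i := by
    intro x i
    exact (b.restrictScalars_repr_apply ℤ (LinearEquiv.ofEq _ _ hb x) i).symm
  refine ⟨((Int.castAddHom (ZMod p)).compLeft _).comp c.equivFun.toAddEquiv.toAddMonoidHom,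
    fun g => ?_, fun x => ?_⟩
  · choose f hf using fun i => ZMod.intCast_surjective (g i)
    refine ⟨c.equivFun.symm f, ?_⟩
    funext i
    simp [hf, Finsupp.single_apply]
  · rw [exists_eq_zsmul_iff p hb, funext_iff]
    refine forall_congr' fun i => ?_
    have : (((c.repr x i : ℤ)) : ZMod p) = 0 ↔ ∃ k : ℤ, b.repr x i = p * k := by
      rw [ZMod.intCast_zmod_eq_zero_iff_dvd, hrepr]
      exact exists_congr fun k => by exact_mod_cast Iff.rfl
    exact this

/-- On these combinations `Q / (2t)` is an integral ternary form, hence isotropic modulo `p`. The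
cases `t = 1` and `t = p` serve the two residue forms. -/
theorem exists_combination_dvd (L : QLattice V) {t : ℚ} {x : Fin 3 → V}
    (hQ : ∀ i, ∃ k : ℤ, L.Q (x i) = 2 * t * k)
    (hB : ∀ i j, ∃ k : ℤ, L.form (x i) (x j) = t * k) :
    ∃ a : Fin 3 → ℤ, (∃ i, ¬ (p : ℤ) ∣ a i) ∧
      ∃ k : ℤ, L.Q (∑ i, a i • x i) = 2 * t * p * k := by
  choose d hd using hQ
  choose c hc using hB
  obtain ⟨v, hv, hv0⟩ := exists_isotropic_of_fin_three p
    ![![(d 0 : ZMod p), c 0 1, c 0 2], ![0, d 1, c 1 2], ![0, 0, d 2]]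
  simp only [Fin.sum_univ_three, Matrix.cons_val_zero, Matrix.cons_val_one, Matrix.cons_val] at hv0
  choose a ha using fun i => ZMod.intCast_surjective (v i)
  have hdvd : (p : ℤ) ∣ d 0 * a 0 ^ 2 + d 1 * a 1 ^ 2 + d 2 * a 2 ^ 2 + c 0 1 * (a 0 * a 1) +
      c 0 2 * (a 0 * a 2) + c 1 2 * (a 1 * a 2) := by
    rw [← ZMod.intCast_zmod_eq_zero_iff_dvd]
    push_cast [ha]
    linear_combination hv0
  obtain ⟨k, hk⟩ := hdvd
  refine ⟨a, ?_, k, ?_⟩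
  · by_contra! hcon
    apply hv
    funext i
    rw [← ha i, Pi.zero_apply, ZMod.intCast_zmod_eq_zero_iff_dvd]
    exact hcon i
  · have hk' := congrArg (fun z : ℤ => (z : ℚ)) hk
    push_cast at hk'
    simp only [Fin.sum_univ_three, Q_add, Q_zsmul, hd, map_add, LinearMap.add_apply, map_zsmul,
      LinearMap.smul_apply, hc, zsmul_eq_mul]
    linear_combination 2 * t * hk'

/-- A pair of vectors that is anisotropic modulo `p` represents all `p`-adic units, up to
scaling. -/
theorem exists_localForm_eq_unit {L : QLattice V} {t : ℤ} {x : Fin 2 → V}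
    (hx : ∀ i, x i ∈ L.lat) (hQ : ∀ i, ∃ k : ℤ, L.Q (x i) = 2 * t * k)
    (hB : ∀ i j, ∃ k : ℤ, L.form (x i) (x j) = t * k)
    (h : ∀ a : Fin 2 → ℤ, (∃ k : ℤ, L.Q (∑ i, a i • x i) = 2 * t * p * k) → ∀ i, (p : ℤ) ∣ a i)
    {u : ℤ_[p]} (hu : IsUnit u) :
    ∃ y ∈ L.localLat p, L.localForm p y y = 2 * t * u := by
  obtain ⟨k, hk⟩ := hQ 0
  obtain ⟨l, hl⟩ := hQ 1
  obtain ⟨c, hc⟩ := hB 0 1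
  obtain ⟨α, β, hαβ⟩ := exists_eq_unit_of_anisotropic_binary p (a := k) (b := c) (c := l)
    (fun a b ⟨j, hj⟩ => by
      have := h ![a, b] ⟨j, by
        have hj' := congrArg (fun z : ℤ => (z : ℚ)) hj
        push_cast at hj'
        simp only [Fin.sum_univ_two, Q_add, Q_zsmul, hk, hl, map_zsmul,
          LinearMap.smul_apply, hc, zsmul_eq_mul, Matrix.cons_val_zero, Matrix.cons_val_one]
        linear_combination 2 * t * hj'⟩
      exact ⟨this 0, this 1⟩) hu
  set X := (1 : ℚ_[p]) ⊗ₜ[ℚ] x 0 with hX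
  set Y := (1 : ℚ_[p]) ⊗ₜ[ℚ] x 1 with hY
  have hXX : L.localForm p X X = 2 * t * k := by
    rw [hX, localForm_tmul, ← Q, hk]
    push_cast
    rfl
  have hYY : L.localForm p Y Y = 2 * t * l := by
    rw [hY, localForm_tmul, ← Q, hl]
    push_cast
    rfl
  have hXY : L.localForm p X Y = t * c := by
    rw [hX, hY, localForm_tmul, hc]
    push_cast
    rfl
  have hYX : L.localForm p Y X = t * c := by rw [localForm_symm, hXY]
  refine ⟨α • X + β • Y, Submodule.add_mem _ (Submodule.smul_mem _ _ (tmul_mem_localLat p (hx 0)))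
    (Submodule.smul_mem _ _ (tmul_mem_localLat p (hx 1))), ?_⟩
  have hαβ' := congrArg (fun z : ℤ_[p] => (z : ℚ_[p])) hαβ
  push_cast at hαβ'
  simp only [map_add, LinearMap.add_apply, localForm_smul_left, localForm_smul_right, hXX, hYY,
    hXY, hYX]
  linear_combination 2 * (t : ℚ_[p]) * hαβ'

/-- The two residue forms of an anisotropic lattice of rank at least `4` are both binary. -/
theorem exists_anisotropic_pairs {L : QLattice V} (hL : L.IsNormalized)
    (hrank : 4 ≤ Module.finrank ℚ V) (hs : L.IsWatsonAnisotropic p)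
    (hdvd : ∀ x ∈ L.lat, (∃ k : ℤ, L.Q x = 2 * p ^ 2 * k) → ∃ y ∈ L.lat, x = (p : ℤ) • y) :
    (∃ x : Fin 2 → V, (∀ i, x i ∈ L.lat) ∧
      ∀ a : Fin 2 → ℤ, (∃ k : ℤ, L.Q (∑ i, a i • x i) = 2 * p * k) → ∀ i, (p : ℤ) ∣ a i) ∧
    ∃ x : Fin 2 → V, (∀ i, x i ∈ L.watsonLat (2 * p)) ∧
      ∀ a : Fin 2 → ℤ, (∃ k : ℤ, L.Q (∑ i, a i • x i) = 2 * p * p * k) → ∀ i, (p : ℤ) ∣ a i := by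
  have hmem := hs.mem_watsonLat_iff p
  obtain ⟨π, hπ, hker⟩ := L.exists_mod_map p
  let A₁ : AddSubgroup L.lat := ((L.watsonLat (2 * p)).comap L.lat.subtype).toAddSubgroup
  -- `F` is `Λ/pL` inside `L/pL`, with quotient `L/Λ`, where `Λ = Λ_{2p}(L)`.
  let F : Submodule (ZMod p) (Fin (Module.finrank ℚ V) → ZMod p) :=
    AddSubgroup.toZModSubmodule p (A₁.map π)
  have hF : ∀ e, e ∈ F ↔ ∃ x ∈ A₁, π x = e := fun e => Iff.rfl
  have hπF : ∀ x : L.lat, π x ∈ F ↔ (x : V) ∈ L.watsonLat (2 * p) := by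
    intro x
    rw [hF]
    constructor
    · rintro ⟨y, hy, hxy⟩
      have h0 : π (x - y) = 0 := by rw [map_sub, hxy, sub_self]
      obtain ⟨z, hz, hxz⟩ := (hker _).mp h0
      have h1 : (x : V) = (p : ℤ) • z + y := by
        rw [← hxz]
        simp
      rw [h1]
      exact Submodule.add_mem _ (zsmul_mem_watsonLat p hL hz) hy
    · exact fun hx => ⟨x, hx, rfl⟩
  let π₀ : L.lat →+ ((Fin (Module.finrank ℚ V) → ZMod p) ⧸ F) := F.mkQ.toAddMonoidHom.comp π
  have hπ₀ : Function.Surjective π₀ := F.mkQ_surjective.comp hπ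
  have hker₀ : ∀ x : L.lat, π₀ x = 0 ↔ (x : V) ∈ L.watsonLat (2 * p) := fun x => by
    rw [← hπF]
    exact Submodule.Quotient.mk_eq_zero F
  let π₁ : A₁ →+ F := (π.comp A₁.subtype).codRestrict F fun x => (hπF _).mpr x.2
  have hπ₁ : Function.Surjective π₁ := by
    rintro ⟨e, he⟩
    obtain ⟨x, hx, rfl⟩ := (hF e).mp he
    exact ⟨⟨x, hx⟩, rfl⟩
  have hker₁ : ∀ x : A₁, π₁ x = 0 ↔ ∃ y ∈ L.lat, ((x : L.lat) : V) = (p : ℤ) • y := fun x => by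
    rw [← hker]
    exact Subtype.ext_iff
  have hsum₀ : ∀ {k : ℕ} (a : Fin k → ℤ) (x : Fin k → L.lat),
      ((∑ i, a i • x i : L.lat) : V) = ∑ i, a i • (x i : V) := fun a x => by simp
  have hsum₁ : ∀ {k : ℕ} (a : Fin k → ℤ) (x : Fin k → A₁),
      (((∑ i, a i • x i : A₁) : L.lat) : V) = ∑ i, a i • ((x i : L.lat) : V) := fun a x => by simp
  have hint := (isIntegral_iff L).mp hL.1
  -- Three independent classes in `L/Λ` would have a nontrivial combination with `Q ∈ 2pℤ`, which
  -- lies in `Λ`.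
  have hle₀ : Module.finrank (ZMod p) ((Fin (Module.finrank ℚ V) → ZMod p) ⧸ F) ≤ 2 := by
    by_contra! hcon
    obtain ⟨x, hx⟩ := exists_indep_of_le_finrank p π₀ hπ₀ hcon
    obtain ⟨a, ⟨i, hi⟩, k, hk⟩ := L.exists_combination_dvd p (t := 1) (x := fun i => (x i : V))
      (fun i => by simpa using hL.even (x i).2)
      (fun i j => by simpa using hint _ (x i).2 _ (x j).2)
    refine hi (hx a ((hker₀ _).mpr ((hmem _).mpr ⟨Subtype.property _, k, ?_⟩)) i)
    rw [hsum₀, hk]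
    ring
  -- The same with `t = p`: a combination with `Q ∈ 2p²ℤ` lies in `pL` by `hdvd`.
  have hle₁ : Module.finrank (ZMod p) F ≤ 2 := by
    by_contra! hcon
    obtain ⟨x, hx⟩ := exists_indep_of_le_finrank p π₁ hπ₁ hcon
    obtain ⟨a, ⟨i, hi⟩, k, hk⟩ := L.exists_combination_dvd p (t := p)
      (x := fun i => ((x i : L.lat) : V)) (fun i => ((hmem _).mp (x i).2).2)
      (fun i j => hs _ (x i : L.lat).2 ((hmem _).mp (x i).2).2 _ (x j : L.lat).2)
    refine hi (hx a ((hker₁ _).mpr (hdvd _ (Subtype.property _) ⟨k, ?_⟩)) i)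
    rw [hsum₁, hk]
    ring
  have hadd := Submodule.finrank_quotient_add_finrank F
  rw [Module.finrank_fin_fun] at hadd
  constructor
  · obtain ⟨x, hx⟩ := exists_indep_of_le_finrank p π₀ hπ₀ (n := 2) (by omega)
    refine ⟨fun i => x i, fun i => (x i).2, fun a ⟨k, hk⟩ => hx a ?_⟩
    exact (hker₀ _).mpr ((hmem _).mpr ⟨Subtype.property _, k, by rw [hsum₀, hk]⟩)
  · obtain ⟨x, hx⟩ := exists_indep_of_le_finrank p π₁ hπ₁ (n := 2) (by omega)
    refine ⟨fun i => (x i : L.lat), fun i => (x i).2, fun a ⟨k, hk⟩ => hx a ?_⟩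
    exact (hker₁ _).mpr (hdvd _ (Subtype.property _) ⟨k, by rw [hsum₁, hk]; ring⟩)

/-- The residue forms supply all `2u` and all `2pu` with `u` a unit; multiplying vectors by `p^e`
shifts the valuation by `2e`, so both parities are covered. -/
theorem localValues_eq_of_anisotropic {L : QLattice V} (hL : L.IsNormalized)
    (hrank : 4 ≤ Module.finrank ℚ V) (hs : L.IsWatsonAnisotropic p)
    (hdvd : ∀ x ∈ L.lat, (∃ k : ℤ, L.Q x = 2 * p ^ 2 * k) → ∃ y ∈ L.lat, x = (p : ℤ) • y) :
    L.localValues p = {a : ℚ_[p] | ∃ z : ℤ_[p], a = 2 * (z : ℚ_[p])} := by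
  obtain ⟨⟨x, hx, hxa⟩, y, hy, hya⟩ := exists_anisotropic_pairs p hL hrank hs hdvd
  have hmem := hs.mem_watsonLat_iff p
  have hunit : ∀ u : ℤ_[p], IsUnit u → ∃ v ∈ L.localLat p, L.localForm p v v = 2 * u := by
    intro u hu
    obtain ⟨v, hv, hvu⟩ := exists_localForm_eq_unit p (t := 1) hx
      (fun i => by simpa using hL.even (hx i))
      (fun i j => by simpa using (isIntegral_iff L).mp hL.1 _ (hx i) _ (hx j))
      (fun a ha => hxa a (by simpa using ha)) hu
    exact ⟨v, hv, by simpa using hvu⟩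
  have hpunit : ∀ u : ℤ_[p], IsUnit u →
      ∃ v ∈ L.localLat p, L.localForm p v v = 2 * (p * u) := by
    intro u hu
    have hy' := fun i => (hmem _).mp (hy i)
    obtain ⟨v, hv, hvu⟩ := exists_localForm_eq_unit p (t := p) (fun i => (hy' i).1)
      (fun i => by exact_mod_cast (hy' i).2)
      (fun i j => by exact_mod_cast hs _ (hy' i).1 (hy' i).2 _ (hy' j).1)
      (fun a ha => hya a (by exact_mod_cast ha)) hu
    refine ⟨v, hv, ?_⟩
    rw [hvu]
    push_cast
    ring
  have hscale : ∀ (e : ℕ) (v : ℚ_[p] ⊗[ℚ] V), v ∈ L.localLat p → ∀ b : ℚ_[p],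
      L.localForm p v v = 2 * b → ∃ w ∈ L.localLat p, 2 * (b * p ^ (2 * e)) =
        L.localForm p w w := by
    intro e v hv b hb
    refine ⟨(p ^ e : ℤ_[p]) • v, Submodule.smul_mem _ _ hv, ?_⟩
    rw [localForm_smul_left, localForm_smul_right, hb]
    push_cast
    ring
  ext a
  constructor
  · rintro ⟨x, hx, rfl⟩
    exact hL.localForm_even p hx
  · rintro ⟨z, rfl⟩
    by_cases hz : z = 0
    · exact ⟨0, Submodule.zero_mem _, by simp [hz]⟩
    · have hspec := congrArg (fun z : ℤ_[p] => (z : ℚ_[p])) (PadicInt.unitCoeff_spec hz)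
      push_cast at hspec
      rcases Nat.even_or_odd' z.valuation with ⟨e, he | he⟩
      · obtain ⟨v, hv, hvu⟩ := hunit _ (PadicInt.unitCoeff hz).isUnit
        obtain ⟨w, hw, hwv⟩ := hscale e v hv _ hvu
        exact ⟨w, hw, by rw [← hwv, hspec, he]⟩
      · obtain ⟨v, hv, hvu⟩ := hpunit _ (PadicInt.unitCoeff hz).isUnit
        obtain ⟨w, hw, hwv⟩ := hscale e v hv _ hvu
        refine ⟨w, hw, ?_⟩
        rw [← hwv, hspec, he, pow_succ]
        ring

end Anisotropic

end QLattice

/-! ### The dichotomy: all stages anisotropic, or a hyperbolic plane -/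

theorem corollary3p5 {V : Type u} [AddCommGroup V] [Module ℚ V] (L : QLattice V) (n : ℕ)
    (hnorm : L.IsNormalized) (hreg : L.IsStrictlyRegular n) (hrank : 4 ≤ L.rank)
    (p : ℕ) [hp : Fact p.Prime] :
    ∃ r : List {r : ℚ // 0 < r},
      L.Admissible (2 * p) (Nat.mul_pos two_pos hp.out.pos) r ∧
      (L.watsonSeq (2 * p) (Nat.mul_pos two_pos hp.out.pos) r).IsNormalized ∧
      (L.watsonSeq (2 * p) (Nat.mul_pos two_pos hp.out.pos) r).IsStrictlyRegular n ∧
      (L.watsonSeq (2 * p) (Nat.mul_pos two_pos hp.out.pos) r).localValues p =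
        {a : ℚ_[p] | ∃ z : ℤ_[p], a = 2 * (z : ℚ_[p])} ∧
      (∀ (q : ℕ) [Fact q.Prime], q ≠ p →
        ∃ c : ℚ, 0 < c ∧ L.LocallyIsometricScaled q (c : ℚ_[q])
          (L.watsonSeq (2 * p) (Nat.mul_pos two_pos hp.out.pos) r)) ∧
      (L.IsIsotropicAt p →
        (L.watsonSeq (2 * p) (Nat.mul_pos two_pos hp.out.pos) r).IsSplitByHyperbolicAt p) := by
  by_cases hall : ∀ r m, QLattice.IsWatsonChain p (Nat.mul_pos two_pos hp.out.pos) n L r m →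
      (L.watsonSeq (2 * p) (Nat.mul_pos two_pos hp.out.pos) r).IsWatsonAnisotropic p
  · obtain ⟨m₀, hm₀⟩ := QLattice.exists_bound_dvd p hnorm
    -- The extra 1 guarantees `m ≠ 0`, as the descent requires.
    obtain ⟨r, m, hm, hr⟩ := QLattice.exists_isWatsonChain_ge hnorm hreg hall (m₀ + 1)
    have hdvd : ∀ x ∈ L.lat, (∃ k : ℤ, L.Q x = 2 * p ^ m * k) → ∃ y ∈ L.lat, x = (p : ℤ) • y :=
      fun x hx hk => hm₀ m (by omega) _ hr.mem_iff x ((hr.mem_iff x).mpr ⟨hx, hk⟩)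
    refine ⟨r, hr.admissible, hr.normalized, hr.regular, ?_,
      fun q _ hq => hr.locallyIsometricScaled hnorm hq,
      fun h => absurd h (QLattice.not_isIsotropicAt p hnorm (by omega) hdvd)⟩
    refine QLattice.localValues_eq_of_anisotropic p hr.normalized hrank (hall r m hr) ?_
    rintro x hx ⟨k, hk⟩
    have hp0 : (p : ℚ) ≠ 0 := by exact_mod_cast hp.out.ne_zero
    -- Divisibility by `p` passes from `L` to the final lattice: in terms of `L` the value lies in
    -- `2p^(m+2) ℤ`, so `x = p y` with `Q y ∈ 2p^m ℤ`, and `y` is in the final lattice too.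
    have hxL : L.Q x = 2 * p ^ m * (p ^ 2 * k) := by
      rw [hr.Q_eq] at hk
      field_simp at hk
      linear_combination hk
    obtain ⟨y, hy, rfl⟩ := hdvd x ((hr.mem_iff x).mp hx).1 ⟨p ^ 2 * k, by
      rw [hxL]; push_cast; rfl⟩
    refine ⟨y, (hr.mem_iff y).mpr ⟨hy, k, ?_⟩, rfl⟩
    rw [QLattice.Q_zsmul] at hxL
    push_cast at hxL
    refine mul_left_cancel₀ (pow_ne_zero 2 hp0) ?_
    linear_combination hxL
  · push Not at hall
    obtain ⟨r, m, hr, hs⟩ := hall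
    have hsplit := QLattice.isSplitByHyperbolicAt_of_not_isWatsonAnisotropic hr.normalized hs
    exact ⟨r, hr.admissible, hr.normalized, hr.regular, hsplit.localValues_eq p hr.normalized,
      fun q _ hq => hr.locallyIsometricScaled hnorm hq, fun _ => hsplit⟩
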